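/- Let $T$ be the infinite rooted binary tree whose vertices are the finite words over $\{0,1\}$, every word $t$ being joined to $t0$ and $t1$, and let $W=\mathrm{Aut}(T)$, a profinite group with $W\cong\varprojlim_n \mathrm{Aut}(T_n)$, where $T_n$ is the subtree of words of length $\le n$. For $u,v\in W$ let $(u,v)\in W$ denote the element $0t\mapsto 0\,u(t)$, $1t\mapsto 1\,v(t)$, and let $\sigma\in W$ be the element $0t\mapsto 1t$, $1t\mapsto 0t$. Let $a_1,a_2,a_3\in W$ be the elements determined by $$a_1=\sigma,\qquad a_2=(a_1,1),\qquad a_3=(a_2,a_3),$$ let $G\subset W$ be the closed subgroup topologically generated by $a_1,a_2,a_3$ (the strictly pre-periodic case with $s=2$ and $r=3$), and let $N$ be the normalizer of $G$ in $W$. Let $w_0\in W$ be the element determined by $w_0=(a_2w_0,a_3w_0)$, and let $$w_1=(1,(a_2a_3)^2),\qquad w_{i+1}=(w_i,w_i)\quad\text{for all } i\ge1.$$ For $i\ge0$ and $k\in\mathbb{F}_2$ put $w_i^k=1$ if $k=0$ and $w_i^k=w_i$ if $k=1$. Then for every $(k_0,k_1,\ldots)\in\prod_{i=0}^\infty\mathbb{F}_2$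 the infinite product $\phi(k_0,k_1,\ldots)=w_0^{k_0}w_1^{k_1}w_2^{k_2}\cdots$ converges in $W$ to an element of $N$, and the map $\phi\colon\prod_{i=0}^\infty\mathbb{F}_2\to N$ induces an isomorphism of topological groups $$\bar\phi\colon\ \prod_{i=0}^\infty\mathbb{F}_2\ \stackrel{\sim}{\longrightarrow}\ N/G,\qquad (k_0,k_1,\ldots)\mapsto\phi(k_0,k_1,\ldots)\,G .$$ -/

import Mathlib

open Filter Topology

namespace RootedBinary

/-- The infinite regular binary tree `T`: its vertices are the finite words over `{0, 1}`
(`false` is the letter `0`, `true` the letter `1`), and every word `t` is joined to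
`t0` and `t1`. -/
def tree : SimpleGraph (List Bool) where
  Adj s t := (∃ b, t = s ++ [b]) ∨ ∃ b, s = t ++ [b]
  symm := ⟨fun _ _ h => h.symm⟩
  loopless := ⟨fun s h => by rcases h with ⟨b, h⟩ | ⟨b, h⟩ <;> simp at h⟩

/-- `W = Aut(T)`, with composition `(w * w') t = w (w' t)` as the group law. -/
abbrev W : Type := tree ≃g tree

/-- The profinite topology of `W`: the coarsest one for which every map `w ↦ w t` into the
discrete set of vertices is continuous, i.e. the topology of the inverse limit of the finite
groups `Aut(T_n)`. -/
instance instTopologicalSpaceW : TopologicalSpace W :=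
  ⨅ t : List Bool, TopologicalSpace.induced (fun w : W => w t) ⊥

theorem isOpen_apply_eq (t s : List Bool) : IsOpen {w : W | w t = s} := by
  have h : IsOpen[TopologicalSpace.induced (fun w : W => w t) ⊥] {w : W | w t = s} :=
    ⟨{s}, trivial, rfl⟩
  exact (iInf_le (fun t : List Bool => TopologicalSpace.induced (fun w : W => w t) ⊥) t) _ h

theorem continuous_of_isOpen {X : Type*} [TopologicalSpace X] {f : X → W}
    (h : ∀ t s : List Bool, IsOpen {x | f x t = s}) : Continuous f := by
  refine continuous_iInf_rng.2 fun t => continuous_induced_rng.2 ?_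
  let _ : TopologicalSpace (List Bool) := ⊥
  have : DiscreteTopology (List Bool) := ⟨rfl⟩
  exact continuous_discrete_rng.2 fun s => h t s

/-- Limits in `W` are unique. -/
instance instT2SpaceW : T2Space W where
  t2 x y hxy := by
    obtain ⟨t, ht⟩ : ∃ t, x t ≠ y t := by
      by_contra h
      push Not at h
      exact hxy (RelIso.ext h)
    refine ⟨_, _, isOpen_apply_eq t (x t), isOpen_apply_eq t (y t), rfl, rfl, ?_⟩
    exact Set.disjoint_left.2 fun w h₁ h₂ => ht (h₁.symm.trans h₂)

instance instIsTopologicalGroupW : IsTopologicalGroup W where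
  continuous_mul := by
    refine continuous_of_isOpen fun t s => ?_
    have : {p : W × W | (p.1 * p.2) t = s} =
        ⋃ r : List Bool, {w : W | w r = s} ×ˢ {w : W | w t = r} := by
      ext p
      simp [RelIso.mul_apply]
    rw [this]
    exact isOpen_iUnion fun r => (isOpen_apply_eq r s).prod (isOpen_apply_eq t r)
  continuous_inv := by
    refine continuous_of_isOpen fun t s => ?_
    have : {w : W | w⁻¹ t = s} = {w : W | w s = t} := by
      ext w
      constructor
      · rintro rfl
        exact RelIso.apply_inv_self w t
      · rintro rfl
        exact RelIso.inv_apply_self w s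
    rw [this]
    exact isOpen_apply_eq s t

/-! ### Automorphisms fix the root and preserve children -/

theorem apply_nil (w : W) : w [] = [] := by
  rcases List.eq_nil_or_concat (w []) with h | ⟨s, b, h⟩
  · exact h
  · exfalso
    have key : ∀ x : List Bool, tree.Adj (w []) x → ∃ c, w.symm x = [c] := by
      intro x hx
      have : tree.Adj (w.symm (w [])) (w.symm x) := w.symm.map_rel_iff.2 hx
      rw [RelIso.symm_apply_apply] at this
      rcases this with ⟨c, hc⟩ | ⟨c, hc⟩
      · exact ⟨c, by simpa using hc⟩
      · simp at hc
    obtain ⟨c₁, h₁⟩ := key s (Or.inr ⟨b, by simpa using h⟩)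
    obtain ⟨c₂, h₂⟩ := key (w [] ++ [false]) (Or.inl ⟨_, rfl⟩)
    obtain ⟨c₃, h₃⟩ := key (w [] ++ [true]) (Or.inl ⟨_, rfl⟩)
    have e : ∀ {x y : List Bool}, w.symm x = w.symm y → x = y := fun h => w.symm.injective h
    have n₁₂ : c₁ ≠ c₂ := by
      rintro rfl
      have := congrArg List.length (e (h₁.trans h₂.symm))
      rw [h] at this
      simp at this
    have n₁₃ : c₁ ≠ c₃ := by
      rintro rfl
      have := congrArg List.length (e (h₁.trans h₃.symm))
      rw [h] at this
      simp at this
    have n₂₃ : c₂ ≠ c₃ := by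
      rintro rfl
      have := e (h₂.trans h₃.symm)
      simp at this
    revert n₁₂ n₁₃ n₂₃
    cases c₁ <;> cases c₂ <;> cases c₃ <;> simp

theorem apply_append (w : W) (t : List Bool) : ∀ b, ∃ c, w (t ++ [b]) = w t ++ [c] := by
  induction t using List.reverseRecOn with
  | nil =>
    intro b
    have h : tree.Adj (w []) (w ([] ++ [b])) := w.map_rel_iff.2 (Or.inl ⟨b, rfl⟩)
    rcases h with h | ⟨c, hc⟩
    · exact h
    · rw [apply_nil] at hc
      simp at hc
  | append_singleton s a ih =>
    intro b
    have h : tree.Adj (w (s ++ [a])) (w (s ++ [a] ++ [b])) := w.map_rel_iff.2 (Or.inl ⟨b, rfl⟩)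
    rcases h with h | ⟨c, hc⟩
    · exact h
    · exfalso
      obtain ⟨d, hd⟩ := ih a
      rw [hd] at hc
      have h' := (List.append_inj' hc rfl).1
      have := congrArg List.length (w.injective h')
      simp at this

/-! ### Building automorphisms -/

theorem length_of_append {f : List Bool → List Bool} (h0 : f [] = [])
    (hc : ∀ t b, ∃ c, f (t ++ [b]) = f t ++ [c]) (t : List Bool) :
    (f t).length = t.length := by
  induction t using List.reverseRecOn with
  | nil => rw [h0]
  | append_singleton s a ih =>
    obtain ⟨c, h⟩ := hc s a
    rw [h]
    simp [ih]

theorem bijective_of_append {f : List Bool → List Bool} (h0 : f [] = [])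
    (hc : ∀ t b, ∃ c, f (t ++ [b]) = f t ++ [c]) (hinj : Function.Injective f) :
    Function.Bijective f := by
  refine ⟨hinj, fun s => ?_⟩
  let g : List.Vector Bool s.length → List.Vector Bool s.length :=
    fun t => ⟨f t.1, (length_of_append h0 hc t.1).trans t.2⟩
  have hg : Function.Injective g := fun x y h =>
    Subtype.ext (hinj (congrArg Subtype.val h))
  obtain ⟨t, ht⟩ := (Finite.injective_iff_surjective.1 hg) ⟨s, rfl⟩
  exact ⟨t.1, congrArg Subtype.val ht⟩

/-- An injective map of words that fixes the empty word and sends children of `t` to children of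
the image of `t`, as an automorphism of the tree. -/
noncomputable def ofFun (f : List Bool → List Bool) (h0 : f [] = [])
    (hc : ∀ t b, ∃ c, f (t ++ [b]) = f t ++ [c]) (hinj : Function.Injective f) : W where
  toEquiv := Equiv.ofBijective f (bijective_of_append h0 hc hinj)
  map_rel_iff' := by
    have key : ∀ s t : List Bool, (∃ b, f t = f s ++ [b]) ↔ ∃ b, t = s ++ [b] := by
      intro s t
      constructor
      · rintro ⟨b, h⟩
        rcases List.eq_nil_or_concat t with rfl | ⟨t', c, rfl⟩
        · rw [h0] at h
          simp at h
        · rw [List.concat_eq_append] at h ⊢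
          obtain ⟨d, hd⟩ := hc t' c
          have h2 := hd.symm.trans h
          exact ⟨c, by rw [hinj (List.append_inj' h2 rfl).1]⟩
      · rintro ⟨b, rfl⟩
        exact hc s b
    intro s t
    exact or_congr (key s t) (key t s)

/-- The action of `(u, v)` on words: `0t ↦ 0 u(t)` and `1t ↦ 1 v(t)`. -/
def pairFun (u v : W) : List Bool → List Bool
  | [] => []
  | false :: t => false :: u t
  | true :: t => true :: v t

/-- The element `(u, v)` of `W`, for `u, v ∈ W`. -/
noncomputable def pair (u v : W) : W :=
  ofFun (pairFun u v) rfl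
    (by
      rintro (_ | ⟨_ | _, t⟩) b
      · cases b
        · exact ⟨false, by simp [pairFun, apply_nil]⟩
        · exact ⟨true, by simp [pairFun, apply_nil]⟩
      · obtain ⟨c, h⟩ := apply_append u t b
        exact ⟨c, by simp [pairFun, h]⟩
      · obtain ⟨c, h⟩ := apply_append v t b
        exact ⟨c, by simp [pairFun, h]⟩)
    (by
      rintro (_ | ⟨_ | _, s⟩) (_ | ⟨_ | _, t⟩) h <;> simp [pairFun] at h ⊢ <;> exact h)

/-- The action of `σ` on words: `0t ↦ 1t` and `1t ↦ 0t`. -/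
def sigmaFun : List Bool → List Bool
  | [] => []
  | b :: t => (!b) :: t

/-- The element `σ` of `W`. -/
noncomputable def sigma : W :=
  ofFun sigmaFun rfl
    (by
      rintro (_ | ⟨a, t⟩) b
      · exact ⟨!b, rfl⟩
      · exact ⟨b, rfl⟩)
    (by
      rintro (_ | ⟨a, s⟩) (_ | ⟨b, t⟩) h <;> simp [sigmaFun] at h ⊢ <;> exact h)

/-! ### The generators `a₁ = σ`, `a₂ = (a₁, 1)`, `a₃ = (a₂, a₃)` and the group `G` -/

/-- `a₁ = σ`. -/
noncomputable def a₁ : W := sigma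

/-- `a₂ = (a₁, 1)`. -/
noncomputable def a₂ : W := pair a₁ 1

/-- The action of `a₃` on words: `0t ↦ 0 a₂(t)` and `1t ↦ 1 a₃(t)`. -/
noncomputable def a₃Fun : List Bool → List Bool
  | [] => []
  | false :: t => false :: a₂ t
  | true :: t => true :: a₃Fun t

/-- The element `a₃` of `W` determined by `a₃ = (a₂, a₃)`; see `a₃_eq`. -/
noncomputable def a₃ : W :=
  ofFun a₃Fun rfl
    (by
      intro t b
      induction t with
      | nil => cases b <;> simp [a₃Fun, apply_nil]
      | cons a t ih =>
        obtain ⟨c, hc⟩ := ih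
        obtain ⟨d, hd⟩ := apply_append a₂ t b
        cases a
        · exact ⟨d, by simp [a₃Fun, hd]⟩
        · exact ⟨c, by simp [a₃Fun, hc]⟩)
    (by
      intro s
      induction s with
      | nil => rintro (_ | ⟨_ | _, t⟩) h <;> simp [a₃Fun] at h ⊢
      | cons a s ih =>
        rintro (_ | ⟨b, t⟩) h
        · cases a <;> simp [a₃Fun] at h
        · cases a <;> cases b <;> simp [a₃Fun] at h ⊢
          · exact h
          · exact ih h)

theorem a₃_eq : a₃ = pair a₂ a₃ := by
  refine RelIso.ext ?_
  rintro (_ | ⟨_ | _, t⟩) <;> rfl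

/-- `G`, the closed subgroup of `W` generated by `a₁, a₂, a₃`. -/
noncomputable def G : Subgroup W :=
  (Subgroup.closure {a₁, a₂, a₃}).topologicalClosure

/-- `N`, the normalizer of `G` in `W`. -/
noncomputable def N : Subgroup W := Subgroup.normalizer (G : Set W)

instance instNormalG : (G.subgroupOf N).Normal :=
  inferInstanceAs (G.subgroupOf (Subgroup.normalizer (G : Set W))).Normal

/-! ### The elements `w₀, w₁, w₂, …` -/

/-- The action of `w₀` on words: `0t ↦ 0 a₂(w₀(t))` and `1t ↦ 1 a₃(w₀(t))`. -/
noncomputable def w₀Fun : List Bool → List Bool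
  | [] => []
  | false :: t => false :: a₂ (w₀Fun t)
  | true :: t => true :: a₃ (w₀Fun t)

/-- The element `w₀` of `W` determined by `w₀ = (a₂ w₀, a₃ w₀)`; see `w₀_eq`. -/
noncomputable def w₀ : W :=
  ofFun w₀Fun rfl
    (by
      intro t b
      induction t with
      | nil => cases b <;> simp [w₀Fun, apply_nil]
      | cons a t ih =>
        obtain ⟨c, hc⟩ := ih
        cases a
        · obtain ⟨d, hd⟩ := apply_append a₂ (w₀Fun t) c
          exact ⟨d, by simp [w₀Fun, hc, hd]⟩
        · obtain ⟨d, hd⟩ := apply_append a₃ (w₀Fun t) c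
          exact ⟨d, by simp [w₀Fun, hc, hd]⟩)
    (by
      intro s
      induction s with
      | nil => rintro (_ | ⟨_ | _, t⟩) h <;> simp [w₀Fun] at h ⊢
      | cons a s ih =>
        rintro (_ | ⟨b, t⟩) h
        · cases a <;> simp [w₀Fun] at h
        · cases a <;> cases b <;> simp [w₀Fun] at h ⊢ <;> exact ih h)

theorem w₀_eq : w₀ = pair (a₂ * w₀) (a₃ * w₀) := by
  refine RelIso.ext ?_
  rintro (_ | ⟨_ | _, t⟩) <;> rfl

/-- The sequence `w₀`, `w₁ = (1, (a₂ a₃)²)`, `w_{i+1} = (w_i, w_i)` for `i ≥ 1`. -/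
noncomputable def w : ℕ → W
  | 0 => w₀
  | 1 => pair 1 ((a₂ * a₃) ^ 2)
  | i + 2 => pair (w (i + 1)) (w (i + 1))

/-- The partial product `w₀^{k₀} w₁^{k₁} ⋯ w_{n-1}^{k_{n-1}}`, in this order, where `w_i^0 = 1` and
`w_i^1 = w_i` for the two elements `0, 1` of `𝔽₂`. -/
noncomputable def partialProd (k : ℕ → ZMod 2) (n : ℕ) : W :=
  ((List.range n).map fun i => if k i = 0 then 1 else w i).prod

end RootedBinary

namespace RootedBinary

/-! The group `G` is cut out by explicit congruences, and `N / G` is read off from them. The parity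
of the activity on each level is a homomorphism. Modulo those `h` with `(1, h) ∈ Γ`, where `Γ` is
generated by `a₁, a₂, a₃`, the group `Γ` becomes dihedral of order 8, generated by `a₂` and `a₃`.
Its coordinates are `parity 1`, `parity 2` and the cochain `cochC`, whose coboundary on `G` is the
cup product of `parity 2` and `parity 1`. `RootCond` says that, in these coordinates, the section at
`1` is the image of the section at `0` under the automorphism exchanging `a₂` and `a₃`. Imposed at
every vertex it defines a closed subgroup `S`; `exists_isSmall` approximates its elements by `Γ` on
every level, so `G_eq_S`.

If `w` normalizes `S`, so do its sections, and these differ by an element of `S`; conjugating `a₁`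
and `a₃` by `w` yields further relations between parities. They make the functions `kappa i`
homomorphisms from `N` to `𝔽₂` that kill `S`. Conversely, if all `kappa i` vanish at `w`, then
`RootCond` holds for every section of `w`, so the joint kernel is `S` (`mem_S_of_kappa_eq_zero`).
Since `kappa i (w j)` is the Kronecker delta (`kappa_w`) and the `w i` act trivially on deeper and
deeper levels, the infinite product is a continuous section of the coordinates (`kappa_infProd`).
Injectivity of the coordinates on `N / G` then makes the two maps mutually inverse. -/

/-! ### Sections of automorphisms -/

/-- Whether `w` exchanges the two children of the root. -/
def act (w : W) : Bool := (w [false]).headD false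

theorem apply_singleton (w : W) (b : Bool) : w [b] = [xor b (act w)] := by
  have key : ∀ b, ∃ c, w [b] = [c] := fun b => by
    simpa [apply_nil] using apply_append w [] b
  obtain ⟨c, hc⟩ := key false
  obtain ⟨d, hd⟩ := key true
  have hne : c ≠ d := by
    rintro rfl
    simpa using w.injective (hc.trans hd.symm)
  have ha : act w = c := by simp [act, hc]
  cases b
  · simp [hc, ha]
  · rw [hd, ha]
    revert hne
    cases c <;> cases d <;> simp

theorem exists_apply_cons (w : W) (b : Bool) (t : List Bool) :
    ∃ s, w (b :: t) = xor b (act w) :: s := by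
  induction t using List.reverseRecOn with
  | nil => exact ⟨[], apply_singleton w b⟩
  | append_singleton t a ih =>
    obtain ⟨s, hs⟩ := ih
    obtain ⟨c, hc⟩ := apply_append w (b :: t) a
    exact ⟨s ++ [c], by simpa [hs] using hc⟩

/-- The section of `w` at the child `b` of the root. -/
noncomputable def sec (w : W) (b : Bool) : W :=
  ofFun (fun t => (w (b :: t)).tail) (by simp [apply_singleton])
    (by
      intro t a
      obtain ⟨s, hs⟩ := exists_apply_cons w b t
      obtain ⟨c, hc⟩ := apply_append w (b :: t) a
      refine ⟨c, ?_⟩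
      rw [← List.cons_append, hc, hs]
      rfl)
    (by
      intro s t h
      obtain ⟨s', hs⟩ := exists_apply_cons w b s
      obtain ⟨t', ht⟩ := exists_apply_cons w b t
      simp only [hs, ht, List.tail_cons] at h
      exact (List.cons_inj_right b).1 (w.injective (hs.trans (h ▸ ht.symm))))

theorem apply_cons (w : W) (b : Bool) (t : List Bool) :
    w (b :: t) = xor b (act w) :: sec w b t := by
  obtain ⟨s, hs⟩ := exists_apply_cons w b t
  have : sec w b t = (w (b :: t)).tail := rfl
  rw [this, hs]
  rfl

theorem act_eq_and_sec_eq {w : W} {k : Bool} {v : Bool → W}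
    (h : ∀ b t, w (b :: t) = xor b k :: v b t) : act w = k ∧ ∀ b, sec w b = v b := by
  have h' : ∀ b t, xor b (act w) = xor b k ∧ sec w b t = v b t := fun b t => by
    simpa [apply_cons] using h b t
  exact ⟨by simpa using (h' false []).1, fun b => RelIso.ext fun t => (h' b t).2⟩

theorem ext_sec {v w : W} (h : act v = act w) (hs : ∀ b, sec v b = sec w b) : v = w := by
  refine RelIso.ext ?_
  rintro (_ | ⟨b, t⟩)
  · simp [apply_nil]
  · rw [apply_cons, apply_cons, h, hs]

theorem act_mul_and_sec_mul (v w : W) :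
    act (v * w) = xor (act v) (act w) ∧
      ∀ b, sec (v * w) b = sec v (xor b (act w)) * sec w b :=
  act_eq_and_sec_eq fun b t => by
    simp [RelIso.mul_apply, apply_cons, Bool.xor_comm, Bool.xor_left_comm]

@[simp] theorem act_mul (v w : W) : act (v * w) = xor (act v) (act w) := (act_mul_and_sec_mul v w).1

theorem sec_mul (v w : W) (b : Bool) :
    sec (v * w) b = sec v (xor b (act w)) * sec w b := (act_mul_and_sec_mul v w).2 b

@[simp] theorem act_one : act 1 = false := rfl

@[simp] theorem sec_one (b : Bool) : sec 1 b = 1 := RelIso.ext fun _ => rfl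

@[simp] theorem act_inv (w : W) : act w⁻¹ = act w := by
  have := act_mul w⁻¹ w
  rw [inv_mul_cancel, act_one] at this
  revert this
  cases act w⁻¹ <;> cases act w <;> simp

theorem sec_inv (w : W) (b : Bool) : sec w⁻¹ b = (sec w (xor b (act w)))⁻¹ := by
  rw [eq_inv_iff_mul_eq_one, ← sec_one (xor b (act w)), ← inv_mul_cancel w, sec_mul]
  simp

@[simp] theorem act_pair (u v : W) : act (pair u v) = false := rfl

@[simp] theorem sec_pair_false (u v : W) : sec (pair u v) false = u := RelIso.ext fun _ => rfl

@[simp] theorem sec_pair_true (u v : W) : sec (pair u v) true = v := RelIso.ext fun _ => rfl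

@[simp] theorem act_a₁ : act a₁ = true := rfl

@[simp] theorem sec_a₁ (b : Bool) : sec a₁ b = 1 := RelIso.ext fun _ => rfl

@[simp] theorem act_a₂ : act a₂ = false := rfl

@[simp] theorem sec_a₂_false : sec a₂ false = a₁ := sec_pair_false _ _

@[simp] theorem sec_a₂_true : sec a₂ true = 1 := sec_pair_true _ _

@[simp] theorem act_a₃ : act a₃ = false := rfl

@[simp] theorem sec_a₃_false : sec a₃ false = a₂ := RelIso.ext fun _ => rfl

@[simp] theorem sec_a₃_true : sec a₃ true = a₃ := RelIso.ext fun _ => rfl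

@[simp] theorem act_w₀ : act w₀ = false := rfl

@[simp] theorem sec_w₀_false : sec w₀ false = a₂ * w₀ := RelIso.ext fun _ => rfl

@[simp] theorem sec_w₀_true : sec w₀ true = a₃ * w₀ := RelIso.ext fun _ => rfl

theorem pair_mul (u v u' v' : W) : pair u v * pair u' v' = pair (u * u') (v * v') :=
  ext_sec (by simp) (by rintro (_ | _) <;> simp [sec_mul])

theorem pair_inv (u v : W) : (pair u v)⁻¹ = pair u⁻¹ v⁻¹ :=
  ext_sec (by simp) (by rintro (_ | _) <;> simp [sec_inv])

theorem pair_one : pair 1 1 = 1 := ext_sec (by simp) (by rintro (_ | _) <;> simp)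

theorem a₁_mul_self : a₁ * a₁ = 1 := ext_sec (by simp) (by simp [sec_mul])

theorem a₂_mul_self : a₂ * a₂ = 1 :=
  ext_sec (by simp) (by rintro (_ | _) <;> simp [sec_mul, a₁_mul_self])

theorem a₃_mul_self : a₃ * a₃ = 1 := by
  have key : ∀ t, (a₃ * a₃) t = t := by
    intro t
    induction t with
    | nil => exact apply_nil _
    | cons b t ih =>
      rw [apply_cons, sec_mul]
      cases b
      · simp [a₂_mul_self]
      · simpa using ih
  exact RelIso.ext key

/-! ### Convergence in `W` -/

theorem tendsto_nhds_induced_bot {α X β : Type*} {l : Filter α} {f : α → X} {g : X → β} {x : X}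
    (h : ∀ᶠ i in l, g (f i) = g x) :
    Tendsto f l (@nhds X (TopologicalSpace.induced g ⊥) x) := by
  let _ : TopologicalSpace β := ⊥
  have : DiscreteTopology β := ⟨rfl⟩
  rw [nhds_induced, tendsto_comap_iff, nhds_discrete]
  exact tendsto_pure.2 h

theorem tendsto_nhds_iff {α : Type*} {l : Filter α} {f : α → W} {v : W} :
    Tendsto f l (𝓝 v) ↔ ∀ t, ∀ᶠ i in l, f i t = v t := by
  constructor
  · intro h t
    exact h.eventually ((isOpen_apply_eq t (v t)).mem_nhds rfl)
  · intro h
    rw [nhds_iInf, tendsto_iInf]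
    intro t
    exact tendsto_nhds_induced_bot (h t)

theorem continuous_sec (b : Bool) : Continuous fun w : W => sec w b := by
  refine continuous_iff_continuousAt.2 fun v => tendsto_nhds_iff.2 fun t => ?_
  filter_upwards [(isOpen_apply_eq (b :: t) (v (b :: t))).mem_nhds rfl] with w hw
  exact congrArg List.tail hw

theorem continuous_act : Continuous act := by
  refine continuous_iff_continuousAt.2 fun v => ?_
  refine tendsto_nhds_of_eventually_eq ?_
  filter_upwards [(isOpen_apply_eq [false] (v [false])).mem_nhds rfl] with w hw
  exact congrArg (fun s => List.headD s false) hw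

/-! ### Parities of the activity on the levels -/

/-- The parity of the number of vertices of level `n` at which `w` is active. -/
noncomputable def parity : ℕ → W → ZMod 2
  | 0, w => if act w then 1 else 0
  | n + 1, w => parity n (sec w false) + parity n (sec w true)

theorem parity_zero (w : W) : parity 0 w = if act w then 1 else 0 := rfl

theorem parity_succ (n : ℕ) (w : W) :
    parity (n + 1) w = parity n (sec w false) + parity n (sec w true) := rfl

theorem parity_mul (n : ℕ) (v w : W) : parity n (v * w) = parity n v + parity n w := by
  induction n generalizing v w with
  | zero =>
    simp only [parity_zero, act_mul]
    cases act v <;> cases act w <;> decide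
  | succ n ih =>
    simp only [parity_succ, sec_mul, ih]
    cases act w <;> simp <;> ring

@[simp] theorem parity_one (n : ℕ) : parity n 1 = 0 := by
  simpa using parity_mul n 1 1

@[simp] theorem parity_inv (n : ℕ) (w : W) : parity n w⁻¹ = parity n w := by
  have := parity_mul n w⁻¹ w
  rw [inv_mul_cancel, parity_one] at this
  exact CharTwo.add_eq_zero.1 this.symm

theorem continuous_parity (n : ℕ) : Continuous (parity n) := by
  induction n with
  | zero =>
    exact (continuous_of_discreteTopology (f := fun b : Bool => if b then (1 : ZMod 2) else 0)).comp
      continuous_act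
  | succ n ih => exact (ih.comp (continuous_sec _)).add (ih.comp (continuous_sec _))

theorem parity_a₁ (n : ℕ) : parity n a₁ = if n = 0 then 1 else 0 := by
  cases n <;> simp [parity_zero, parity_succ]

theorem parity_a₂ (n : ℕ) : parity n a₂ = if n = 1 then 1 else 0 := by
  cases n <;> simp [parity_zero, parity_succ, parity_a₁]

@[simp] theorem parity_zero_a₃ : parity 0 a₃ = 0 := by simp [parity_zero]

@[simp] theorem parity_one_a₃ : parity 1 a₃ = 0 := by simp [parity_succ, parity_zero]

@[simp] theorem parity_two_a₃ : parity 2 a₃ = 1 := by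
  rw [parity_succ]; simp [parity_a₂]

/-! ### The functions whose coboundaries are cup products of parities -/

theorem zmodTwo_mul_self (a : ZMod 2) : a * a = a := by revert a; decide

/-- The sum of the parities on the levels `1` and `2`. -/
noncomputable def beta (w : W) : ZMod 2 := parity 1 w + parity 2 w

theorem beta_mul (v w : W) : beta (v * w) = beta v + beta w := by
  simp only [beta, parity_mul]; ring

@[simp] theorem beta_one : beta 1 = 0 := by simp [beta]

@[simp] theorem beta_inv (w : W) : beta w⁻¹ = beta w := by simp [beta]

theorem continuous_beta : Continuous beta := (continuous_parity 1).add (continuous_parity 2)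

/-- A cochain on `W` with coboundary the cup product of `beta` and `parity 0`. -/
noncomputable def cochE (w : W) : ZMod 2 := parity 0 (sec w true) + parity 1 (sec w true)

/-- If `w` swaps the children, the section of `v` that enters is the one at `0` instead of `1`. The
error is `parity 0 + parity 1` summed over both sections of `v`, which is `beta v`. -/
theorem cochE_mul (v w : W) :
    cochE (v * w) = cochE v + cochE w + beta v * parity 0 w := by
  simp only [cochE, beta, sec_mul, parity_mul, parity_succ 1 v, parity_succ 0 v, parity_zero w]
  cases act w <;> simp <;> grind

@[simp] theorem cochE_one : cochE 1 = 0 := by simp [cochE]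

theorem cochE_inv (w : W) : cochE w⁻¹ = cochE w + beta w * parity 0 w := by
  have := cochE_mul w⁻¹ w
  rw [inv_mul_cancel, cochE_one, beta_inv] at this
  grind

theorem continuous_cochE : Continuous cochE :=
  ((continuous_parity 0).comp (continuous_sec _)).add ((continuous_parity 1).comp (continuous_sec _))

/-- A cochain on `W` whose coboundary on `G` is the cup product of `parity 2` and `parity 1`. -/
noncomputable def cochC (w : W) : ZMod 2 := cochE (sec w false) + cochE (sec w true)

/-- Each child contributes `beta` of a section of `v` times `parity 0` of a section of `w`. The
hypothesis gives the first factors the common value `parity 2 v`, and the second factors add up to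
`parity 1 w`. -/
theorem cochC_mul {v : W} (h : ∀ b, beta (sec v b) = parity 2 v) (w : W) :
    cochC (v * w) = cochC v + cochC w + parity 2 v * parity 1 w := by
  have h0 := h false
  have h1 := h true
  simp only [cochC, sec_mul, cochE_mul, parity_succ 0 w]
  cases act w <;> simp only [Bool.xor_false, Bool.xor_true, Bool.not_false, Bool.not_true, h0, h1]
    <;> ring

@[simp] theorem cochC_one : cochC 1 = 0 := by simp [cochC]

theorem continuous_cochC : Continuous cochC :=
  (continuous_cochE.comp (continuous_sec _)).add (continuous_cochE.comp (continuous_sec _))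

/-- If both sections of `u` have the same `beta`, then conjugation by `u` changes `cochC` by a
combination of parities. -/
theorem cochC_conj {u h : W} (hu : beta (sec u true) = beta (sec u false))
    (hh : ∀ b, beta (sec h b) = parity 2 h) :
    cochC (u⁻¹ * h * u) =
      cochC h + beta (sec u false) * parity 1 h + parity 1 u * parity 2 h := by
  have h0 := hh false
  have h1 := hh true
  simp only [cochC, sec_mul, sec_inv, cochE_mul, beta_mul, cochE_inv, beta_inv, parity_succ 0 u,
    parity_succ 0 h]
  cases act u <;> cases act h <;> simp [h0, h1, hu] <;> grind

/-! ### The recursive description of `G` -/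

/-- The condition which an element of `G` satisfies at the root. -/
def RootCond (w : W) : Prop :=
  parity 1 (sec w true) = parity 2 (sec w false) ∧
    parity 2 (sec w true) = parity 1 (sec w false) ∧
      cochC (sec w true) =
        cochC (sec w false) + parity 1 (sec w false) * parity 2 (sec w false)

theorem RootCond.beta_sec {w : W} (h : RootCond w) (b : Bool) :
    beta (sec w b) = parity 2 w := by
  obtain ⟨h1, h2, -⟩ := h
  cases b <;> simp only [beta, parity_succ 1 w, h1, h2] <;> ring

theorem rootCond_one : RootCond 1 := by simp [RootCond]

/-- Exchanging `a₂` and `a₃` is an involutive automorphism of the dihedral group, so the relation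
survives products and a swap of the two sections. The sections of `v` must satisfy it too, because
`cochC_mul` is applied to them. -/
theorem RootCond.mul {v w : W} (hv : RootCond v) (hw : RootCond w)
    (hv' : ∀ b, RootCond (sec v b)) : RootCond (v * w) := by
  have key : ∀ a b, cochC (sec v a * sec w b) = _ := fun a b => cochC_mul (hv' a).beta_sec (sec w b)
  obtain ⟨h1, h2, h3⟩ := hv
  obtain ⟨h1', h2', h3'⟩ := hw
  simp only [RootCond, sec_mul, parity_mul, key, h1', h2', h3']
  have q1 := zmodTwo_mul_self (parity 1 (sec v false))
  have q2 := zmodTwo_mul_self (parity 2 (sec v false))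
  have q3 := zmodTwo_mul_self (parity 1 (sec w false))
  have q4 := zmodTwo_mul_self (parity 2 (sec w false))
  cases act w <;> simp [h1, h2, h3] <;> grind

theorem RootCond.inv {w : W} (hw : RootCond w) (hw' : ∀ b, RootCond (sec w b)) :
    RootCond w⁻¹ := by
  have key : ∀ b, cochC (sec w b)⁻¹ = cochC (sec w b) + parity 2 (sec w b) * parity 1 (sec w b) := by
    intro b
    have := cochC_mul (hw' b).beta_sec (sec w b)⁻¹
    rw [mul_inv_cancel, cochC_one, parity_inv] at this
    grind
  obtain ⟨h1, h2, h3⟩ := hw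
  simp only [RootCond, sec_inv, parity_inv, key]
  cases act w <;> simp [h1, h2, h3] <;> grind

/-- The section of `w` at the word `t`. -/
noncomputable def secWord (w : W) (t : List Bool) : W := t.foldl sec w

theorem rootCond_secWord {P : W → Prop} (hP : ∀ w, P w → RootCond w ∧ ∀ b, P (sec w b)) {w : W}
    (hw : P w) (t : List Bool) : RootCond (secWord w t) := by
  induction t generalizing w with
  | nil => exact (hP w hw).1
  | cons b t ih => exact ih ((hP w hw).2 b)

/-- The elements of `W` all of whose sections satisfy `RootCond`. -/
def selfSimilarSet : Set W := {w | ∀ t, RootCond (secWord w t)}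

theorem mem_selfSimilarSet {P : W → Prop} (hP : ∀ w, P w → RootCond w ∧ ∀ b, P (sec w b)) {w : W}
    (hw : P w) : w ∈ selfSimilarSet := rootCond_secWord hP hw

theorem rootCond_of_mem {w : W} (hw : w ∈ selfSimilarSet) : RootCond w := hw []

theorem sec_mem_selfSimilarSet {w : W} (hw : w ∈ selfSimilarSet) (b : Bool) :
    sec w b ∈ selfSimilarSet := fun t => hw (b :: t)

/-- The subgroup of all elements of `W` all of whose sections satisfy `RootCond`. -/
noncomputable def S : Subgroup W where
  carrier := selfSimilarSet
  one_mem' := mem_selfSimilarSet (P := fun w => w = 1)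
    (by rintro _ rfl; exact ⟨rootCond_one, sec_one⟩) rfl
  mul_mem' {v w} hv hw :=
    mem_selfSimilarSet
      (P := fun u => ∃ v ∈ selfSimilarSet, ∃ w ∈ selfSimilarSet, u = v * w)
      (by
        rintro _ ⟨v, hv, w, hw, rfl⟩
        refine ⟨(rootCond_of_mem hv).mul (rootCond_of_mem hw)
          fun b => rootCond_of_mem (sec_mem_selfSimilarSet hv b), fun b => ?_⟩
        exact ⟨_, sec_mem_selfSimilarSet hv _, _, sec_mem_selfSimilarSet hw b, sec_mul v w b⟩)
      ⟨v, hv, w, hw, rfl⟩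
  inv_mem' {w} hw :=
    mem_selfSimilarSet (P := fun u => ∃ w ∈ selfSimilarSet, u = w⁻¹)
      (by
        rintro _ ⟨w, hw, rfl⟩
        refine ⟨(rootCond_of_mem hw).inv
          fun b => rootCond_of_mem (sec_mem_selfSimilarSet hw b), fun b => ?_⟩
        exact ⟨_, sec_mem_selfSimilarSet hw _, sec_inv w b⟩)
      ⟨w, hw, rfl⟩

/-- A coinduction principle: it handles elements such as `a₃` and the conjugates by `w₀`, whose
sections are again of the same kind. -/
theorem mem_S_of {P : W → Prop} (hP : ∀ w, P w → RootCond w ∧ ∀ b, P (sec w b)) {w : W}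
    (hw : P w) : w ∈ S := rootCond_secWord hP hw

theorem rootCond_of_mem_S {w : W} (hw : w ∈ S) : RootCond w := hw []

theorem sec_mem_S {w : W} (hw : w ∈ S) (b : Bool) : sec w b ∈ S := fun t => hw (b :: t)

theorem mem_S_of_sec {w : W} (h : RootCond w) (hs : ∀ b, sec w b ∈ S) : w ∈ S := by
  rintro (_ | ⟨b, t⟩)
  · exact h
  · exact hs b t

theorem beta_sec_of_mem_S {w : W} (hw : w ∈ S) (b : Bool) : beta (sec w b) = parity 2 w :=
  (rootCond_of_mem_S hw).beta_sec b

theorem cochC_mul_of_mem_S {v : W} (hv : v ∈ S) (w : W) :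
    cochC (v * w) = cochC v + cochC w + parity 2 v * parity 1 w :=
  cochC_mul (beta_sec_of_mem_S hv) w

theorem cochC_inv_of_mem_S {w : W} (hw : w ∈ S) :
    cochC w⁻¹ = cochC w + parity 2 w * parity 1 w := by
  have := cochC_mul_of_mem_S hw w⁻¹
  rw [mul_inv_cancel, cochC_one, parity_inv] at this
  grind

theorem isClosed_S : IsClosed (S : Set W) := by
  have hc : ∀ t, Continuous fun w => secWord w t := by
    intro t
    induction t with
    | nil => exact continuous_id
    | cons b t ih => exact ih.comp (continuous_sec b)
  have hr : IsClosed {w | RootCond w} := by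
    have h : ∀ n b, Continuous fun w => parity n (sec w b) :=
      fun n b => (continuous_parity n).comp (continuous_sec b)
    have h' : ∀ b, Continuous fun w => cochC (sec w b) :=
      fun b => continuous_cochC.comp (continuous_sec b)
    exact (isClosed_eq (h _ _) (h _ _)).inter ((isClosed_eq (h _ _) (h _ _)).inter
      (isClosed_eq (h' _) ((h' _).add ((h _ _).mul (h _ _)))))
  have : (S : Set W) = ⋂ t, (fun w => secWord w t) ⁻¹' {w | RootCond w} := by
    ext w
    simp only [Set.mem_iInter]
    rfl
  rw [this]
  exact isClosed_iInter fun t => hr.preimage (hc t)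

/-! ### The generators lie in `S` -/

@[simp] theorem cochE_a₁ : cochE a₁ = 0 := by simp [cochE]
@[simp] theorem cochE_a₂ : cochE a₂ = 0 := by simp [cochE]
@[simp] theorem cochE_a₃ : cochE a₃ = 0 := by simp [cochE]
@[simp] theorem cochC_a₁ : cochC a₁ = 0 := by simp [cochC]
@[simp] theorem cochC_a₂ : cochC a₂ = 0 := by simp [cochC]
@[simp] theorem cochC_a₃ : cochC a₃ = 0 := by simp [cochC]

theorem a₁_mem_S : a₁ ∈ S :=
  mem_S_of_sec (by simp [RootCond]) fun b => by simp [S.one_mem]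

theorem a₂_mem_S : a₂ ∈ S :=
  mem_S_of_sec (by simp [RootCond, parity_a₁])
    (by rintro (_ | _) <;> simp [a₁_mem_S, S.one_mem])

theorem a₃_mem_S : a₃ ∈ S :=
  mem_S_of (P := fun w => w = a₃ ∨ w ∈ S)
    (by
      rintro w (rfl | hw)
      · refine ⟨by simp [RootCond, parity_a₂], ?_⟩
        rintro (_ | _)
        · exact Or.inr (by simpa using a₂_mem_S)
        · exact Or.inl sec_a₃_true
      · exact ⟨rootCond_of_mem_S hw, fun b => Or.inr (sec_mem_S hw b)⟩)
    (Or.inl rfl)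

/-- The abstract subgroup generated by `a₁`, `a₂`, `a₃`. -/
def Γ : Subgroup W := Subgroup.closure {a₁, a₂, a₃}

theorem a₁_mem_Γ : a₁ ∈ Γ := Subgroup.subset_closure (by simp)
theorem a₂_mem_Γ : a₂ ∈ Γ := Subgroup.subset_closure (by simp)
theorem a₃_mem_Γ : a₃ ∈ Γ := Subgroup.subset_closure (by simp)

theorem Γ_le_S : Γ ≤ S := by
  rw [Γ, Subgroup.closure_le]
  rintro _ (rfl | rfl | rfl)
  exacts [a₁_mem_S, a₂_mem_S, a₃_mem_S]

theorem G_le_S : G ≤ S := Subgroup.topologicalClosure_minimal _ Γ_le_S isClosed_S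

/-! ### Density of the group generated by `a₁`, `a₂`, `a₃` in `S` -/

@[simp] theorem a₁_inv : a₁⁻¹ = a₁ := inv_eq_of_mul_eq_one_right a₁_mul_self
@[simp] theorem a₂_inv : a₂⁻¹ = a₂ := inv_eq_of_mul_eq_one_right a₂_mul_self
@[simp] theorem a₃_inv : a₃⁻¹ = a₃ := inv_eq_of_mul_eq_one_right a₃_mul_self

/-! ### The dihedral group generated by `a₂` and `a₃` -/

/-- The square of `a₂ a₃`, which is the central involution of the dihedral group generated by
`a₂` and `a₃`. -/
noncomputable def rhoSq : W := (a₂ * a₃) ^ 2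

theorem rhoSq_eq : rhoSq = pair (pair a₁ a₁) 1 := by
  have h : a₂ * a₃ = pair (a₁ * a₂) a₃ :=
    ext_sec (by simp) (by rintro (_ | _) <;> simp [sec_mul])
  rw [rhoSq, h, pow_two, pair_mul, a₃_mul_self]
  congr 1
  exact ext_sec (by simp) (by rintro (_ | _) <;> simp [sec_mul])

theorem rhoSq_mem_Γ : rhoSq ∈ Γ := Γ.pow_mem (Γ.mul_mem a₂_mem_Γ a₃_mem_Γ) 2

@[simp] theorem parity_rhoSq (n : ℕ) : parity n rhoSq = 0 := by
  rw [rhoSq, pow_two, parity_mul]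
  exact CharTwo.add_self_eq_zero _

-- No parity sees the commutator of `a₂` and `a₃`; `cochC` does, which makes it the third dihedral
-- coordinate.
@[simp] theorem cochC_rhoSq : cochC rhoSq = 1 := by
  simp [rhoSq_eq, cochC, cochE, parity_zero, parity_succ]

theorem rhoSq_mul_self : rhoSq * rhoSq = 1 := by
  simp [rhoSq_eq, pair_mul, a₁_mul_self, pair_one]

theorem a₃_mul_a₂ : a₃ * a₂ = a₂ * (a₃ * rhoSq) := by
  have h : (a₂ * a₃) * ((a₂ * a₃) * rhoSq) = 1 := by
    rw [← mul_assoc, ← pow_two]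
    exact rhoSq_mul_self
  have := eq_inv_of_mul_eq_one_right h
  rw [mul_inv_rev, a₂_inv, a₃_inv, mul_assoc] at this
  exact this.symm

theorem rhoSq_commute_a₃ : Commute rhoSq a₃ := by
  change rhoSq * a₃ = a₃ * rhoSq
  conv_lhs => rw [a₃_eq, rhoSq_eq, pair_mul]
  conv_rhs => rw [a₃_eq, rhoSq_eq, pair_mul]
  rw [one_mul, mul_one, a₂, pair_mul, pair_mul, one_mul, mul_one]

theorem rhoSq_commute_a₂ : Commute rhoSq a₂ := by
  change rhoSq * a₂ = a₂ * rhoSq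
  rw [a₂, rhoSq_eq, pair_mul, pair_mul]
  congr 1
  exact ext_sec (by simp) (by simp [sec_mul])

/-! ### Cosets of the subgroup of those `h` with `(1, h) ∈ Γ` -/

/-- The subgroup of all `h` such that `(1, h)` lies in the group generated by `a₁`, `a₂`, `a₃`. -/
noncomputable def rightSubgroup : Subgroup W where
  carrier := {h | pair 1 h ∈ Γ}
  one_mem' := by simp [pair_one, Γ.one_mem]
  mul_mem' {u v} hu hv := by
    have := Γ.mul_mem hu hv
    rwa [pair_mul, one_mul] at this
  inv_mem' {u} hu := by
    have := Γ.inv_mem hu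
    rwa [pair_inv, inv_one] at this

theorem mem_rightSubgroup {h : W} : h ∈ rightSubgroup ↔ pair 1 h ∈ Γ := Iff.rfl

theorem pair_swap_mem_Γ {u v : W} (h : pair u v ∈ Γ) : pair v u ∈ Γ := by
  have := Γ.mul_mem (Γ.mul_mem a₁_mem_Γ h) a₁_mem_Γ
  convert this using 1
  exact ext_sec (by simp) (by rintro (_ | _) <;> simp [sec_mul])

/-- The elements `(a₁, 1)`, `(a₂, a₃)` and `(a₃, a₂)` of `Γ` have the three generators as first
coordinates. -/
theorem exists_pair_mem_Γ {g : W} (hg : g ∈ Γ) : ∃ h, pair g h ∈ Γ := by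
  induction hg using Subgroup.closure_induction with
  | mem x hx =>
    rcases hx with rfl | rfl | rfl
    · exact ⟨1, a₂_mem_Γ⟩
    · exact ⟨a₃, a₃_eq ▸ a₃_mem_Γ⟩
    · exact ⟨a₂, pair_swap_mem_Γ (a₃_eq ▸ a₃_mem_Γ)⟩
  | one => exact ⟨1, by simp [pair_one, Γ.one_mem]⟩
  | mul x y _ _ hx hy =>
    obtain ⟨u, hu⟩ := hx
    obtain ⟨v, hv⟩ := hy
    exact ⟨u * v, by simpa [pair_mul] using Γ.mul_mem hu hv⟩
  | inv x _ hx =>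
    obtain ⟨u, hu⟩ := hx
    exact ⟨u⁻¹, by simpa [pair_inv] using Γ.inv_mem hu⟩

theorem a₁_mem_rightSubgroup : a₁ ∈ rightSubgroup := pair_swap_mem_Γ a₂_mem_Γ

theorem conj_mem_rightSubgroup {g h : W} (hg : g ∈ Γ) (hh : h ∈ rightSubgroup) :
    g * h * g⁻¹ ∈ rightSubgroup := by
  obtain ⟨u, hu⟩ := exists_pair_mem_Γ hg
  have hu := pair_swap_mem_Γ hu
  have := Γ.mul_mem (Γ.mul_mem hu hh) (Γ.inv_mem hu)
  simpa [mem_rightSubgroup, pair_mul, pair_inv] using this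

/-- Right multiplication by a generator preserves this normal form: `a₁` is absorbed into
`rightSubgroup` by normality, the other two into the exponents. -/
theorem exists_eq_mul_of_mem_Γ {g : W} (hg : g ∈ Γ) :
    ∃ l ∈ rightSubgroup, ∃ i j k : ℕ, g = l * (a₂ ^ i * a₃ ^ j * rhoSq ^ k) := by
  have step : ∀ x y : W, y ∈ ({a₁, a₂, a₃} : Set W) →
      (∃ l ∈ rightSubgroup, ∃ i j k : ℕ, x = l * (a₂ ^ i * a₃ ^ j * rhoSq ^ k)) →
        ∃ l ∈ rightSubgroup, ∃ i j k : ℕ, x * y = l * (a₂ ^ i * a₃ ^ j * rhoSq ^ k) := by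
    rintro _ y hy ⟨l, hl, i, j, k, rfl⟩
    rcases hy with rfl | rfl | rfl
    · have hd : a₂ ^ i * a₃ ^ j * rhoSq ^ k ∈ Γ :=
        Γ.mul_mem (Γ.mul_mem (Γ.pow_mem a₂_mem_Γ _) (Γ.pow_mem a₃_mem_Γ _))
          (Γ.pow_mem rhoSq_mem_Γ _)
      refine ⟨_, mul_mem hl (conj_mem_rightSubgroup hd a₁_mem_rightSubgroup), i, j, k, ?_⟩
      group
    -- Moving `a₂` to the left past `a₃ ^ j` creates `rhoSq ^ j`.
    · refine ⟨l, hl, i + 1, j, j + k, ?_⟩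
      have h : SemiconjBy a₂ ((a₃ * rhoSq) ^ j) (a₃ ^ j) :=
        SemiconjBy.pow_right a₃_mul_a₂.symm j
      rw [rhoSq_commute_a₃.symm.mul_pow] at h
      have h2 : rhoSq ^ k * a₂ = a₂ * rhoSq ^ k := (rhoSq_commute_a₂.pow_left k).eq
      calc l * (a₂ ^ i * a₃ ^ j * rhoSq ^ k) * a₂
          = l * (a₂ ^ i * a₃ ^ j * (rhoSq ^ k * a₂)) := by simp only [mul_assoc]
        _ = l * (a₂ ^ i * (a₃ ^ j * a₂) * rhoSq ^ k) := by rw [h2]; simp only [mul_assoc]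
        _ = _ := by rw [← h.eq, pow_succ, pow_add]; simp only [mul_assoc]
    · refine ⟨l, hl, i, j + 1, k, ?_⟩
      have h2 : rhoSq ^ k * a₃ = a₃ * rhoSq ^ k := (rhoSq_commute_a₃.pow_left k).eq
      rw [mul_assoc, mul_assoc _ _ a₃, h2, pow_succ]
      simp only [mul_assoc]
  induction hg using Subgroup.closure_induction_right with
  | one => exact ⟨1, one_mem _, 0, 0, 0, by simp⟩
  | mul_right x _ y hy ih => exact step x y hy ih
  | mul_inv_cancel x _ y hy ih =>
    have : y⁻¹ = y := by rcases hy with rfl | rfl | rfl <;> simp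
    exact this.symm ▸ step x y hy ih

theorem parity_pow (n k : ℕ) (w : W) : parity n (w ^ k) = k * parity n w := by
  induction k with
  | zero => simp
  | succ k ih => rw [pow_succ, parity_mul, ih]; push_cast; ring

theorem pow_eq_one_of_cast_eq_zero {w : W} (hw : w * w = 1) {k : ℕ} (hk : (k : ZMod 2) = 0) :
    w ^ k = 1 := by
  obtain ⟨m, rfl⟩ := (ZMod.natCast_eq_zero_iff k 2).1 hk
  rw [pow_mul, pow_two, hw, one_pow]

theorem cochC_rhoSq_pow (k : ℕ) : cochC (rhoSq ^ k) = k := by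
  induction k with
  | zero => simp
  | succ k ih =>
    rw [pow_succ, cochC_mul_of_mem_S (Γ_le_S (Γ.pow_mem rhoSq_mem_Γ k)), ih]
    simp

/-- In the normal form, `RootCond` for `(1, l)` kills the three coordinates of `l`. Those of `g` are
therefore the exponents mod 2, and their vanishing leaves `g = l`. -/
theorem mem_rightSubgroup_of_mem_Γ {g : W} (hg : g ∈ Γ) (h1 : parity 1 g = 0)
    (h2 : parity 2 g = 0) (hc : cochC g = 0) : g ∈ rightSubgroup := by
  obtain ⟨l, hl, i, j, k, rfl⟩ := exists_eq_mul_of_mem_Γ hg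
  have hl' : pair 1 l ∈ S := Γ_le_S hl
  have hlS : l ∈ S := by simpa using sec_mem_S hl' true
  obtain ⟨l1, l2, lc⟩ := rootCond_of_mem_S hl'
  simp only [sec_pair_false, sec_pair_true, parity_one, cochC_one, mul_zero, add_zero] at l1 l2 lc
  simp only [parity_mul, parity_pow, l1, l2, parity_a₂, parity_one_a₃, parity_two_a₃,
    parity_rhoSq] at h1 h2
  have hi : a₂ ^ i = 1 := pow_eq_one_of_cast_eq_zero a₂_mul_self (by simpa using h1)
  have hj : a₃ ^ j = 1 := pow_eq_one_of_cast_eq_zero a₃_mul_self (by simpa using h2)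
  rw [hi, hj, one_mul, one_mul, cochC_mul_of_mem_S hlS, lc, l2, cochC_rhoSq_pow] at hc
  have hk : rhoSq ^ k = 1 := pow_eq_one_of_cast_eq_zero rhoSq_mul_self (by simpa using hc)
  simpa [hi, hj, hk] using hl

/-- The elements of `S` that fix the words of length at most `n` and on which the cochains
`parity 0`, `parity 1`, `parity 2`, `cochC` and `cochE` vanish. -/
structure IsSmall (n : ℕ) (w : W) : Prop where
  mem : w ∈ S
  parity_zero : parity 0 w = 0
  parity_one : parity 1 w = 0
  parity_two : parity 2 w = 0
  cochC : cochC w = 0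
  cochE : cochE w = 0
  apply_eq : ∀ t : List Bool, t.length ≤ n → w t = t

theorem act_eq_false_iff {w : W} : act w = false ↔ parity 0 w = 0 := by
  rw [parity_zero]
  cases act w <;> simp

theorem IsSmall.of_sec {n : ℕ} {w : W} (hw : w ∈ S) (ha : act w = false)
    (h : ∀ b, IsSmall n (sec w b)) : IsSmall (n + 1) w where
  mem := hw
  parity_zero := act_eq_false_iff.1 ha
  parity_one := by rw [parity_succ, (h _).parity_zero, (h _).parity_zero, add_zero]
  parity_two := by rw [parity_succ, (h _).parity_one, (h _).parity_one, add_zero]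
  cochC := by rw [RootedBinary.cochC, (h _).cochE, (h _).cochE, add_zero]
  cochE := by rw [RootedBinary.cochE, (h _).parity_zero, (h _).parity_one, add_zero]
  apply_eq := by
    rintro (_ | ⟨b, t⟩) ht
    · exact apply_nil w
    · rw [apply_cons, ha, (h b).apply_eq t (by simpa using ht), Bool.xor_false]

theorem exists_mem_Γ_parity (i j k : ZMod 2) :
    ∃ g ∈ Γ, parity 0 g = i ∧ parity 1 g = j ∧ parity 2 g = k := by
  refine ⟨a₁ ^ i.val * a₂ ^ j.val * a₃ ^ k.val, Γ.mul_mem (Γ.mul_mem (Γ.pow_mem a₁_mem_Γ _)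
    (Γ.pow_mem a₂_mem_Γ _)) (Γ.pow_mem a₃_mem_Γ _), ?_⟩
  simp [parity_mul, parity_pow, parity_a₁, parity_a₂]

theorem pair_a₁_a₁_mem_Γ : pair a₁ a₁ ∈ Γ := by
  have := Γ.mul_mem a₂_mem_Γ (pair_swap_mem_Γ a₂_mem_Γ)
  rwa [a₂, pair_mul, one_mul, mul_one] at this

theorem exists_mem_Γ_cochC (i j k l : ZMod 2) :
    ∃ g ∈ Γ, parity 0 g = i ∧ parity 1 g = j ∧ parity 2 g = k ∧ cochC g = l := by
  obtain ⟨g, hg, h0, h1, h2⟩ := exists_mem_Γ_parity i j k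
  refine ⟨g * rhoSq ^ (l - cochC g).val, Γ.mul_mem hg (Γ.pow_mem rhoSq_mem_Γ _), ?_⟩
  simp [cochC_mul_of_mem_S (Γ_le_S hg), parity_mul, parity_pow, h0, h1, h2, cochC_rhoSq_pow]

/-- Products of generators realize the parities; `rhoSq` then adjusts `cochC`, and `(a₁, a₁)`
adjusts `cochE` without disturbing the rest. -/
theorem exists_mem_Γ_cochE (i j k l m : ZMod 2) :
    ∃ g ∈ Γ, parity 0 g = i ∧ parity 1 g = j ∧ parity 2 g = k ∧ cochC g = l ∧ cochE g = m := by
  obtain ⟨g, hg, h0, h1, h2, hc⟩ := exists_mem_Γ_cochC i j k l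
  have hz : ∀ n : ℕ, cochC (pair a₁ a₁ ^ n) = 0 ∧ cochE (pair a₁ a₁ ^ n) = n := by
    intro n
    induction n with
    | zero => simp
    | succ n ih =>
      rw [pow_succ, cochC_mul_of_mem_S (Γ_le_S (Γ.pow_mem pair_a₁_a₁_mem_Γ n)), cochE_mul, ih.1,
        ih.2]
      have h2 : parity 1 (pair a₁ a₁) = 0 := by
        simpa [parity_succ] using CharTwo.add_self_eq_zero _
      rw [h2]
      simp [cochC, cochE, parity_zero, parity_succ]
  have hp : ∀ n, parity n (pair a₁ a₁) = 0 := by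
    rintro (_ | n)
    · simp [parity_zero]
    · simpa [parity_succ] using CharTwo.add_self_eq_zero _
  refine ⟨g * pair a₁ a₁ ^ (m - cochE g).val, Γ.mul_mem hg (Γ.pow_mem pair_a₁_a₁_mem_Γ _), ?_⟩
  simp [cochC_mul_of_mem_S (Γ_le_S hg), cochE_mul, parity_mul, parity_pow, h0, h1, h2, hc, hz, hp]

theorem parity_inv_mul (n : ℕ) (v w : W) : parity n (v⁻¹ * w) = parity n v + parity n w := by
  simp [parity_mul]

theorem cochC_inv_mul {v : W} (hv : v ∈ S) (w : W) :
    cochC (v⁻¹ * w) = cochC v + cochC w + parity 2 v * (parity 1 v + parity 1 w) := by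
  rw [cochC_mul_of_mem_S (S.inv_mem hv), cochC_inv_of_mem_S hv, parity_inv]
  ring

/-- Triviality on the first levels alone would not carry the induction: the cochains must vanish as
well, so that the correction of the right section lifts to some `(1, l)` in `Γ`. -/
theorem exists_isSmall (n : ℕ) : ∀ w ∈ S, ∃ g ∈ Γ, IsSmall n (g⁻¹ * w) := by
  induction n with
  | zero =>
    intro w hw
    obtain ⟨g, hg, h0, h1, h2, hc, he⟩ := exists_mem_Γ_cochE (parity 0 w) (parity 1 w) (parity 2 w)
      (cochC w) (cochE w)
    refine ⟨g, hg, S.mul_mem (S.inv_mem (Γ_le_S hg)) hw, ?_, ?_, ?_, ?_, ?_, ?_⟩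
    · rw [parity_inv_mul, h0, CharTwo.add_self_eq_zero]
    · rw [parity_inv_mul, h1, CharTwo.add_self_eq_zero]
    · rw [parity_inv_mul, h2, CharTwo.add_self_eq_zero]
    · rw [cochC_inv_mul (Γ_le_S hg), hc, h1, CharTwo.add_self_eq_zero, CharTwo.add_self_eq_zero,
        mul_zero, add_zero]
    · rw [cochE_mul, cochE_inv, he, h0, beta_inv]
      grind
    · intro t ht
      rw [List.length_eq_zero_iff.1 (Nat.le_zero.1 ht), apply_nil]
  | succ n ih =>
    have key : ∀ w ∈ S, act w = false → ∃ g ∈ Γ, IsSmall (n + 1) (g⁻¹ * w) := by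
      intro w hw ha
      obtain ⟨g, hg, hgs⟩ := ih _ (sec_mem_S hw false)
      obtain ⟨g', hg'⟩ := exists_pair_mem_Γ hg
      set v := (pair g g')⁻¹ * w with hv
      have hvS : v ∈ S := S.mul_mem (S.inv_mem (Γ_le_S hg')) hw
      have hva : act v = false := by simp [hv, ha]
      have hv0 : sec v false = g⁻¹ * sec w false := by simp [hv, sec_mul, sec_inv, ha]
      rw [← hv0] at hgs
      -- The root condition transfers the vanishing of the dihedral coordinates from the left
      -- section to the right one.
      obtain ⟨c1, c2, c3⟩ := rootCond_of_mem_S hvS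
      rw [hgs.parity_one, hgs.parity_two, hgs.cochC, mul_zero, add_zero] at c3
      rw [hgs.parity_two] at c1
      rw [hgs.parity_one] at c2
      obtain ⟨l, hl, hls⟩ := ih _ (sec_mem_S hvS true)
      have l1 : parity 1 l = 0 := by
        simpa [c1, parity_inv_mul] using hls.parity_one
      have l2 : parity 2 l = 0 := by
        simpa [c2, parity_inv_mul] using hls.parity_two
      have lc : cochC l = 0 := by
        simpa [c3, cochC_inv_mul (Γ_le_S hl), l2] using hls.cochC
      have hl' := mem_rightSubgroup_of_mem_Γ hl l1 l2 lc
      refine ⟨pair g g' * pair 1 l, Γ.mul_mem hg' hl', ?_⟩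
      rw [mul_inv_rev, mul_assoc, ← hv]
      refine IsSmall.of_sec (S.mul_mem (S.inv_mem (Γ_le_S hl')) hvS) (by simp [hva]) ?_
      rintro (_ | _)
      · simpa [sec_mul, sec_inv, hva] using hgs
      · simpa [sec_mul, sec_inv, hva] using hls
    intro w hw
    cases ha : act w
    · exact key w hw ha
    · obtain ⟨g, hg, h⟩ := key (a₁ * w) (S.mul_mem a₁_mem_S hw) (by simp [ha])
      refine ⟨a₁ * g, Γ.mul_mem a₁_mem_Γ hg, ?_⟩
      simpa [mul_assoc] using h

theorem G_eq_S : G = S := by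
  refine le_antisymm G_le_S fun w hw => ?_
  choose g hg hs using fun n => exists_isSmall n w hw
  have ht : Tendsto g atTop (𝓝 w) := by
    refine tendsto_nhds_iff.2 fun t => ?_
    filter_upwards [eventually_ge_atTop t.length] with n hn
    have := (hs n).apply_eq t hn
    rw [RelIso.mul_apply] at this
    rw [← RelIso.apply_inv_self (g n) (w t), this]
  exact mem_closure_of_tendsto ht (Eventually.of_forall hg)

/-! ### Elements of the normalizer -/

theorem mem_N_iff {w : W} : w ∈ N ↔ ∀ h, h ∈ S ↔ w * h * w⁻¹ ∈ S := by
  rw [N, G_eq_S]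
  exact Subgroup.mem_normalizer_iff

theorem conj_mem_S {w h : W} (hw : w ∈ N) (hh : h ∈ S) : w * h * w⁻¹ ∈ S :=
  (mem_N_iff.1 hw h).1 hh

theorem inv_conj_mem_S {w h : W} (hw : w ∈ N) (hh : h ∈ S) : w⁻¹ * h * w ∈ S := by
  simpa using conj_mem_S (N.inv_mem hw) hh

theorem mem_N_of_conj {w : W} (h₁ : ∀ h ∈ S, w⁻¹ * h * w ∈ S) (h₂ : ∀ h ∈ S, w * h * w⁻¹ ∈ S) :
    w ∈ N := by
  refine mem_N_iff.2 fun h => ⟨h₂ h, fun hh => ?_⟩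
  have := h₁ _ hh
  convert this using 1
  group

theorem S_le_N : S ≤ N := fun _ hw =>
  mem_N_of_conj (fun _ hh => S.mul_mem (S.mul_mem (S.inv_mem hw) hh) hw)
    (fun _ hh => S.mul_mem (S.mul_mem hw hh) (S.inv_mem hw))

theorem isClosed_N : IsClosed (N : Set W) := by
  have : (N : Set W) = ⋂ h ∈ S, {w | w⁻¹ * h * w ∈ S} ∩ {w | w * h * w⁻¹ ∈ S} := by
    ext w
    simp only [Set.mem_iInter, Set.mem_inter_iff, Set.mem_ofPred_eq, SetLike.mem_coe]
    exact ⟨fun hw h hh => ⟨inv_conj_mem_S hw hh, conj_mem_S hw hh⟩,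
      fun hw => mem_N_of_conj (fun h hh => (hw h hh).1) (fun h hh => (hw h hh).2)⟩
  rw [this]
  refine isClosed_biInter fun h _ => IsClosed.inter ?_ ?_
  · exact isClosed_S.preimage (f := fun w => w⁻¹ * h * w) (by fun_prop)
  · exact isClosed_S.preimage (f := fun w => w * h * w⁻¹) (by fun_prop)

/-- Only the dihedral coordinates of the other section are constrained, and `Γ` realizes all of
their values. -/
theorem exists_mem_S_sec_eq {h : W} (hh : h ∈ S) (b : Bool) :
    ∃ g ∈ S, act g = false ∧ sec g b = h := by
  obtain ⟨h', hh', -, h1, h2, hc⟩ := exists_mem_Γ_cochC 0 (parity 2 h) (parity 1 h)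
    (cochC h + parity 1 h * parity 2 h)
  have hg : pair h h' ∈ S :=
    mem_S_of_sec (by simp [RootCond, h1, h2, hc]) (by rintro (_ | _) <;> simp [hh, Γ_le_S hh'])
  cases b
  · exact ⟨_, hg, by simp, by simp⟩
  · exact ⟨_, S.mul_mem (S.mul_mem a₁_mem_S hg) a₁_mem_S, by simp, by simp [sec_mul]⟩

theorem sec_inv_mul_mul (w h : W) (b : Bool) :
    sec (w⁻¹ * h * w) b =
      (sec w (xor (xor b (xor (act w) (act h))) (act w)))⁻¹ * sec h (xor b (act w)) * sec w b := by
  simp [sec_mul, sec_inv]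

theorem sec_mem_N {w : W} (hw : w ∈ N) (b : Bool) : sec w b ∈ N := by
  refine mem_N_of_conj (fun h hh => ?_) (fun h hh => ?_)
  · obtain ⟨g, hg, ha, hs⟩ := exists_mem_S_sec_eq hh (xor b (act w))
    have := sec_mem_S (inv_conj_mem_S hw hg) b
    simpa [sec_mul, sec_inv, ha, hs] using this
  · obtain ⟨g, hg, ha, hs⟩ := exists_mem_S_sec_eq hh b
    have := sec_mem_S (conj_mem_S hw hg) (xor b (act w))
    simpa [sec_mul, sec_inv, ha, hs] using this

/-- This is the section at `1` of `w⁻¹ * a₁ * w`. -/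
theorem inv_sec_mul_sec_mem_S {w : W} (hw : w ∈ N) :
    (sec w false)⁻¹ * sec w true ∈ S := by
  have := sec_mem_S (inv_conj_mem_S hw a₁_mem_S) true
  revert this
  cases h : act w <;> simp [sec_mul, sec_inv, h]

theorem beta_sec_of_mem_N {w : W} (hw : w ∈ N) :
    beta (sec w true) = beta (sec w false) := by
  obtain ⟨h, -⟩ := rootCond_of_mem_S (inv_conj_mem_S hw a₁_mem_S)
  have h' : parity 1 (sec w true) + parity 1 (sec w false) =
      parity 2 (sec w true) + parity 2 (sec w false) := by
    revert h
    cases h : act w <;> simp [sec_mul, sec_inv, h, parity_mul] <;> grind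
  rw [beta, beta]
  grind

theorem cochC_conj_of_mem_N {u h : W} (hu : u ∈ N) (hh : h ∈ S) :
    cochC (u⁻¹ * h * u) =
      cochC h + beta (sec u false) * parity 1 h + parity 1 u * parity 2 h :=
  cochC_conj (beta_sec_of_mem_N hu) (beta_sec_of_mem_S hh)

theorem sec_a₁_mul (w : W) (b : Bool) : sec (a₁ * w) b = sec w b := by simp [sec_mul]

/-- To prove a property of `w` which depends only on the sections of `w`, it may be assumed that
`w` fixes the children of the root. -/
theorem sections_induction {P : (Bool → W) → Prop} {K : Subgroup W} (hK : a₁ ∈ K)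
    (h : ∀ w ∈ K, act w = false → P (sec w)) : ∀ w ∈ K, P (sec w) := by
  intro w hw
  cases ha : act w
  · exact h w hw ha
  · have := h (a₁ * w) (K.mul_mem hK hw) (by simp [ha])
    rwa [show sec (a₁ * w) = sec w from funext (sec_a₁_mul w)] at this

/-- This is the `cochC` part of `RootCond` for `w⁻¹ * a₃ * w`, evaluated by `cochC_conj_of_mem_N`.
-/
theorem parity_one_sec_true {w : W} (hw : w ∈ N) :
    parity 1 (sec w true) = beta (sec (sec w false) false) := by
  refine sections_induction
    (P := fun s => parity 1 (s true) = beta (sec (s false) false)) (S_le_N a₁_mem_S)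
    (fun w hw ha => ?_) w hw
  obtain ⟨-, -, h⟩ := rootCond_of_mem_S (inv_conj_mem_S hw a₃_mem_S)
  simpa [sec_inv_mul_mul, ha, cochC_conj_of_mem_N (sec_mem_N hw _) a₃_mem_S,
    cochC_conj_of_mem_N (sec_mem_N hw _) a₂_mem_S, parity_a₂, parity_mul,
    CharTwo.add_self_eq_zero] using h

/-- The section at `0` followed by `beta`, a homomorphism on the normalizer. -/
noncomputable def alpha (w : W) : ZMod 2 := beta (sec w false)

theorem beta_sec_eq_alpha {w : W} (hw : w ∈ N) (b : Bool) : beta (sec w b) = alpha w := by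
  cases b
  · rfl
  · exact beta_sec_of_mem_N hw

theorem alpha_mul {v : W} (hv : v ∈ N) (w : W) : alpha (v * w) = alpha v + alpha w := by
  rw [alpha, sec_mul, beta_mul, beta_sec_eq_alpha hv]
  rfl

theorem alpha_of_mem_S {w : W} (hw : w ∈ S) : alpha w = parity 2 w := beta_sec_of_mem_S hw false

theorem alpha_inv {w : W} (hw : w ∈ N) : alpha w⁻¹ = alpha w := by
  rw [alpha, sec_inv, beta_inv, beta_sec_eq_alpha hw]

/-- A criterion for membership in the normalizer. -/
structure NormCond (w : W) : Prop where
  act_eq : act w = false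
  sec_false : sec w false ∈ N
  sec_true : sec w true ∈ N
  inv_mul : (sec w false)⁻¹ * sec w true ∈ S
  beta_eq : beta (sec w true) = beta (sec w false)
  parity_true : parity 1 (sec w true) = alpha (sec w false)
  parity_false : parity 1 (sec w false) = alpha (sec w true)

theorem NormCond.inv {w : W} (h : NormCond w) : NormCond w⁻¹ where
  act_eq := by simp [h.act_eq]
  sec_false := by simpa [sec_inv, h.act_eq] using h.sec_false
  sec_true := by simpa [sec_inv, h.act_eq] using h.sec_true
  inv_mul := by
    have := S.inv_mem (conj_mem_S h.sec_false h.inv_mul)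
    simpa [sec_inv, h.act_eq, mul_assoc] using this
  beta_eq := by simpa [sec_inv, h.act_eq] using h.beta_eq
  parity_true := by
    simpa [sec_inv, h.act_eq, alpha_inv h.sec_false] using h.parity_true
  parity_false := by
    simpa [sec_inv, h.act_eq, alpha_inv h.sec_true] using h.parity_false

/-- `S` is generated by `a₁` and the elements fixing the children of the root. For the latter, the
two parity conditions make the changes of `cochC` on the two sections compatible. -/
theorem NormCond.inv_conj_mem {w : W} (hw : NormCond w) : ∀ h ∈ S, w⁻¹ * h * w ∈ S := by
  have hs : w⁻¹ * a₁ * w ∈ S := by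
    have hi : (sec w true)⁻¹ * sec w false ∈ S := by simpa using S.inv_mem hw.inv_mul
    refine mem_S_of_sec ?_ ?_
    · have hb := hw.beta_eq
      have e : (sec w false)⁻¹ * sec w true = ((sec w true)⁻¹ * sec w false)⁻¹ := by simp
      simp only [beta] at hb
      simp only [RootCond, sec_inv_mul_mul, hw.act_eq, act_a₁, sec_a₁, Bool.xor_false,
        Bool.xor_true, Bool.not_false, Bool.not_true, mul_one]
      rw [e, cochC_inv_of_mem_S hi]
      simp only [parity_inv, parity_mul]
      refine ⟨?_, ?_, ?_⟩ <;> grind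
    · rintro (_ | _)
      · simpa [sec_inv_mul_mul, hw.act_eq] using hi
      · simpa [sec_inv_mul_mul, hw.act_eq] using hw.inv_mul
  have key : ∀ h ∈ S, act h = false → w⁻¹ * h * w ∈ S := by
    intro h hh ha
    obtain ⟨c1, c2, c3⟩ := rootCond_of_mem_S hh
    refine mem_S_of_sec ?_ ?_
    · have e1 := cochC_conj_of_mem_N hw.sec_true (sec_mem_S hh true)
      have e2 := cochC_conj_of_mem_N hw.sec_false (sec_mem_S hh false)
      rw [← alpha, ← hw.parity_false] at e1
      rw [← alpha, ← hw.parity_true] at e2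
      simp only [RootCond, sec_inv_mul_mul, hw.act_eq, ha, Bool.xor_false]
      simp only [e1, e2, parity_mul, parity_inv, c1, c2, c3]
      refine ⟨?_, ?_, ?_⟩ <;> grind
    · rintro (_ | _)
      · simpa [sec_inv_mul_mul, hw.act_eq, ha] using
          inv_conj_mem_S hw.sec_false (sec_mem_S hh false)
      · simpa [sec_inv_mul_mul, hw.act_eq, ha] using
          inv_conj_mem_S hw.sec_true (sec_mem_S hh true)
  intro h hh
  cases ha : act h
  · exact key h hh ha
  · have := S.mul_mem hs (key (a₁ * h) (S.mul_mem a₁_mem_S hh) (by simp [ha]))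
    convert this using 1
    simp only [mul_assoc, mul_inv_cancel_left]
    rw [← mul_assoc a₁ a₁, a₁_mul_self, one_mul]

theorem NormCond.mem_N {w : W} (h : NormCond w) : w ∈ N :=
  mem_N_of_conj h.inv_conj_mem (by simpa using h.inv.inv_conj_mem)

theorem pair_mem_N {x y : W} (hx : x ∈ N) (hg : x⁻¹ * y ∈ S) (hb : beta y = beta x)
    (hp : parity 1 y = alpha x) : pair x y ∈ N := by
  have hy : y ∈ N := by simpa using N.mul_mem hx (S_le_N hg)
  have ha : parity 1 x = alpha y := by
    have h1 := alpha_mul hx (x⁻¹ * y)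
    rw [mul_inv_cancel_left, alpha_of_mem_S hg, ← hp, parity_inv_mul] at h1
    simp only [beta] at hb
    grind
  exact NormCond.mem_N ⟨by simp, by simpa, by simpa, by simpa, by simpa, by simpa, by simpa⟩

/-! ### The elements `w i` normalize `G` -/

theorem sec_w₀ (b : Bool) : sec w₀ b = sec a₃ b * w₀ := by cases b <;> simp

@[simp] theorem parity_one_w₀ : parity 1 w₀ = 0 := by
  rw [parity_succ]
  simp [parity_mul, parity_zero]

@[simp] theorem parity_two_w₀ : parity 2 w₀ = 1 := by
  rw [parity_succ]
  simp [parity_mul, parity_a₂]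

theorem beta_sec_w₀ (b : Bool) : beta (sec w₀ b) = 0 := by
  cases b <;> simp [beta, parity_mul, parity_a₂, CharTwo.add_self_eq_zero]

@[simp] theorem alpha_w₀ : alpha w₀ = 0 := beta_sec_w₀ false

theorem cochC_inv_conj_w₀ {h : W} (hh : h ∈ S) : cochC (w₀⁻¹ * h * w₀) = cochC h := by
  rw [cochC_conj (by simp only [beta_sec_w₀]) (beta_sec_of_mem_S hh), beta_sec_w₀]
  simp

theorem cochC_conj_w₀ {h : W} (hh : h ∈ S) : cochC (w₀ * h * w₀⁻¹) = cochC h := by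
  have hb : ∀ b, beta (sec w₀⁻¹ b) = 0 := fun b => by rw [sec_inv, beta_inv, beta_sec_w₀]
  have := cochC_conj (u := w₀⁻¹) (by simp only [hb]) (beta_sec_of_mem_S hh)
  rw [inv_inv] at this
  simp [this, hb]

theorem parity_conj (n : ℕ) (u h : W) : parity n (u * h * u⁻¹) = parity n h := by
  simp only [parity_mul, parity_inv]
  grind

theorem parity_inv_conj (n : ℕ) (u h : W) : parity n (u⁻¹ * h * u) = parity n h := by
  simp only [parity_mul, parity_inv]
  grind

/-- `NormCond` would be circular here, as the sections of `w₀` involve `w₀`. But `w₀ = a₃ * (w₀,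
w₀)`, so the sections of a conjugate by `w₀` are again such conjugates, and this conjugation
preserves all dihedral coordinates. -/
theorem inv_conj_w₀_mem_S {h : W} (hh : h ∈ S) : w₀⁻¹ * h * w₀ ∈ S := by
  refine mem_S_of (P := fun u => ∃ h ∈ S, u = w₀⁻¹ * h * w₀) ?_ ⟨h, hh, rfl⟩
  rintro _ ⟨h, hh, rfl⟩
  have hk : a₃⁻¹ * h * a₃ ∈ S := S.mul_mem (S.mul_mem (S.inv_mem a₃_mem_S) hh) a₃_mem_S
  have hs : ∀ b, sec (w₀⁻¹ * h * w₀) b = w₀⁻¹ * sec (a₃⁻¹ * h * a₃) b * w₀ := fun b => by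
    simp only [sec_inv_mul_mul, sec_w₀, act_w₀, act_a₃]
    group
  refine ⟨?_, fun b => ⟨_, sec_mem_S hk b, hs b⟩⟩
  simp only [RootCond, hs, parity_inv_conj, cochC_inv_conj_w₀ (sec_mem_S hk _)]
  exact rootCond_of_mem_S hk

theorem cochC_mul_mul_inv {u h v : W} (hu : u ∈ S) (hh : h ∈ S) (hv : v ∈ S) :
    cochC (u * h * v⁻¹) = cochC u + cochC h + parity 2 u * parity 1 h +
      (cochC v + parity 2 v * parity 1 v) + (parity 2 u + parity 2 h) * parity 1 v := by
  rw [cochC_mul_of_mem_S (S.mul_mem hu hh), cochC_mul_of_mem_S hu, cochC_inv_of_mem_S hv,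
    parity_mul, parity_inv]

theorem sec_mul_mul_inv (w h : W) (b : Bool) (ha : act w = false) :
    sec (w * h * w⁻¹) b = sec w (xor b (act h)) * sec h b * (sec w b)⁻¹ := by
  simp [sec_mul, sec_inv, ha]

theorem conj_w₀_mem_S {h : W} (hh : h ∈ S) : w₀ * h * w₀⁻¹ ∈ S := by
  refine mem_S_of (P := fun u => ∃ h ∈ S, u = w₀ * h * w₀⁻¹) ?_ ⟨h, hh, rfl⟩
  rintro _ ⟨h, hh, rfl⟩
  have hk : a₃ * h * a₃⁻¹ ∈ S := S.mul_mem (S.mul_mem a₃_mem_S hh) (S.inv_mem a₃_mem_S)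
  -- Here `a₃` sits on the wrong side of `w₀`; the inclusion already proved moves its sections
  -- inside the conjugation.
  have hm : ∀ b, w₀⁻¹ * sec a₃ b * w₀ ∈ S := fun b => inv_conj_w₀_mem_S (sec_mem_S a₃_mem_S b)
  have hq : ∀ b, w₀⁻¹ * sec a₃ (xor b (act h)) * w₀ * sec h b * (w₀⁻¹ * sec a₃ b * w₀)⁻¹ ∈ S :=
    fun b => S.mul_mem (S.mul_mem (hm _) (sec_mem_S hh b)) (S.inv_mem (hm b))
  have hs : ∀ b, sec (w₀ * h * w₀⁻¹) b = w₀ *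
      (w₀⁻¹ * sec a₃ (xor b (act h)) * w₀ * sec h b * (w₀⁻¹ * sec a₃ b * w₀)⁻¹) * w₀⁻¹ :=
    fun b => by
      simp only [sec_mul_mul_inv w₀ h b act_w₀, sec_w₀]
      group
  have hc : ∀ b, cochC (sec (w₀ * h * w₀⁻¹) b) = cochC (sec (a₃ * h * a₃⁻¹) b) := fun b => by
    rw [hs, cochC_conj_w₀ (hq b), cochC_mul_mul_inv (hm _) (sec_mem_S hh b) (hm b),
      sec_mul_mul_inv a₃ h b act_a₃, cochC_mul_mul_inv (sec_mem_S a₃_mem_S _) (sec_mem_S hh b)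
        (sec_mem_S a₃_mem_S b)]
    simp only [parity_inv_conj, cochC_inv_conj_w₀ (sec_mem_S a₃_mem_S _)]
  have hp : ∀ n b, parity n (sec (w₀ * h * w₀⁻¹) b) = parity n (sec (a₃ * h * a₃⁻¹) b) :=
    fun n b => by
      rw [hs, parity_conj, sec_mul_mul_inv a₃ h b act_a₃]
      simp only [parity_mul, parity_inv]
      grind
  refine ⟨?_, fun b => ⟨_, hq b, hs b⟩⟩
  simp only [RootCond, hc, hp]
  exact rootCond_of_mem_S hk

theorem w₀_mem_N : w₀ ∈ N :=
  mem_N_of_conj (fun _ hh => inv_conj_w₀_mem_S hh) fun _ hh => conj_w₀_mem_S hh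

theorem parity_pair_self (n : ℕ) (u : W) : parity n (pair u u) = 0 := by
  cases n
  · simp [parity_zero]
  · simpa [parity_succ] using CharTwo.add_self_eq_zero _

theorem w_one : w 1 = pair 1 rhoSq := rfl

theorem parity_w_succ (n i : ℕ) : parity n (w (i + 1)) = 0 := by
  cases i with
  | zero => cases n <;> simp [w_one, parity_zero, parity_succ]
  | succ i => exact parity_pair_self n _

theorem alpha_w_succ (i : ℕ) : alpha (w (i + 1)) = 0 := by
  cases i with
  | zero => simp [alpha, w_one]
  | succ i => simp [alpha, w, beta, parity_w_succ]

theorem rhoSq_mem_S : rhoSq ∈ S := Γ_le_S rhoSq_mem_Γ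

theorem w_mem_N (i : ℕ) : w i ∈ N := by
  rcases i with _ | i
  · exact w₀_mem_N
  induction i with
  | zero =>
    rw [w_one]
    exact pair_mem_N N.one_mem (by simpa using rhoSq_mem_S) (by simp [beta]) (by simp [alpha])
  | succ i ih =>
    exact pair_mem_N ih (by simp [S.one_mem]) rfl (by rw [parity_w_succ, alpha_w_succ])

/-! ### The coordinates on `N / G` -/

/-- The coordinates of an element of the normalizer modulo `G`. -/
noncomputable def kappa : ℕ → W → ZMod 2
  | 0, w => alpha w + parity 2 w
  | 1, w => cochC ((sec w false)⁻¹ * sec w true) + parity 2 (sec w false) +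
      (alpha w + parity 2 w)
  | i + 2, w => kappa (i + 1) (sec w false)

theorem kappa_zero (w : W) : kappa 0 w = alpha w + parity 2 w := rfl

theorem kappa_one (w : W) : kappa 1 w =
    cochC ((sec w false)⁻¹ * sec w true) + parity 2 (sec w false) + kappa 0 w := rfl

theorem kappa_add_two (i : ℕ) (w : W) : kappa (i + 2) w = kappa (i + 1) (sec w false) := rfl

theorem kappa_zero_mul {v w : W} (hv : v ∈ N) :
    kappa 0 (v * w) = kappa 0 v + kappa 0 w := by
  rw [kappa_zero, alpha_mul hv, parity_mul, kappa_zero, kappa_zero]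
  ring

theorem kappa_zero_of_mem_S {w : W} (hw : w ∈ S) : kappa 0 w = 0 := by
  rw [kappa_zero, alpha_of_mem_S hw]
  exact CharTwo.add_self_eq_zero _

/-- If `w` swaps the children, the quotient of the sections of `v` enters inverted, which changes
`cochC`; the summand `parity 2 (sec w false)` in `kappa 1` compensates. The remaining cross terms
cancel by `parity_one_sec_true`. -/
theorem kappa_one_mul {v w : W} (hv : v ∈ N) (hw : w ∈ N) :
    kappa 1 (v * w) = kappa 1 v + kappa 1 w := by
  have hg := inv_sec_mul_sec_mem_S hv
  have hc := cochC_conj_of_mem_N (sec_mem_N hw false) hg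
  have hc' := cochC_conj_of_mem_N (sec_mem_N hw false) (S.inv_mem hg)
  rw [cochC_inv_of_mem_S hg] at hc'
  have hb := beta_sec_of_mem_N hv
  have hp := parity_one_sec_true hw
  have ha := beta_sec_of_mem_N (sec_mem_N hw false)
  simp only [kappa_one, kappa_zero_mul hv, sec_mul]
  cases act w
  · have e : (sec v false * sec w false)⁻¹ * (sec v true * sec w true) =
        ((sec w false)⁻¹ * ((sec v false)⁻¹ * sec v true) * sec w false) *
          ((sec w false)⁻¹ * sec w true) := by group
    simp only [Bool.xor_false, e]
    rw [cochC_mul_of_mem_S (inv_conj_mem_S (sec_mem_N hw false) hg), hc]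
    simp only [parity_mul, parity_inv, beta] at *
    grind
  · have e : (sec v true * sec w false)⁻¹ * (sec v false * sec w true) =
        ((sec w false)⁻¹ * ((sec v false)⁻¹ * sec v true)⁻¹ * sec w false) *
          ((sec w false)⁻¹ * sec w true) := by group
    simp only [Bool.xor_true, Bool.not_false, Bool.not_true, e]
    rw [cochC_mul_of_mem_S (inv_conj_mem_S (sec_mem_N hw false) (S.inv_mem hg)), hc']
    simp only [parity_mul, parity_inv, beta] at *
    have q := zmodTwo_mul_self (parity 1 (sec v false) + parity 1 (sec v true))
    grind

theorem kappa_one_of_mem_S {w : W} (hw : w ∈ S) : kappa 1 w = 0 := by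
  have h := cochC_mul_of_mem_S (sec_mem_S hw false) ((sec w false)⁻¹ * sec w true)
  obtain ⟨h1, h2, h3⟩ := rootCond_of_mem_S hw
  rw [mul_inv_cancel_left, parity_inv_mul, h1, h3] at h
  have q := zmodTwo_mul_self (parity 2 (sec w false))
  rw [kappa_one, kappa_zero_of_mem_S hw]
  grind

/-- The two claims need a joint induction: additivity one step further uses that both sections of
`v` have equal coordinate, which follows from vanishing on `S`. -/
theorem kappa_mul_and_kappa_of_mem_S (i : ℕ) :
    (∀ v ∈ N, ∀ w ∈ N, kappa i (v * w) = kappa i v + kappa i w) ∧ ∀ w ∈ S, kappa i w = 0 := by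
  rcases i with _ | i
  · exact ⟨fun v hv w _ => kappa_zero_mul hv, fun w => kappa_zero_of_mem_S⟩
  induction i with
  | zero => exact ⟨fun v hv w => kappa_one_mul hv, fun w => kappa_one_of_mem_S⟩
  | succ i ih =>
    refine ⟨fun v hv w hw => ?_, fun w hw => ih.2 _ (sec_mem_S hw false)⟩
    rw [kappa_add_two, sec_mul, ih.1 _ (sec_mem_N hv _) _ (sec_mem_N hw _)]
    cases act w
    · rfl
    · have := ih.1 _ (sec_mem_N hv false) _ (S_le_N (inv_sec_mul_sec_mem_S hv))
      rw [mul_inv_cancel_left, ih.2 _ (inv_sec_mul_sec_mem_S hv), add_zero] at this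
      rw [Bool.false_xor, this]
      rfl

theorem kappa_mul (i : ℕ) {v w : W} (hv : v ∈ N) (hw : w ∈ N) :
    kappa i (v * w) = kappa i v + kappa i w := (kappa_mul_and_kappa_of_mem_S i).1 v hv w hw

theorem kappa_of_mem_S (i : ℕ) {w : W} (hw : w ∈ S) : kappa i w = 0 :=
  (kappa_mul_and_kappa_of_mem_S i).2 w hw

@[simp] theorem kappa_apply_one (i : ℕ) : kappa i 1 = 0 := kappa_of_mem_S i S.one_mem

theorem kappa_sec_true (i : ℕ) {w : W} (hw : w ∈ N) :
    kappa i (sec w true) = kappa i (sec w false) := by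
  have h := inv_sec_mul_sec_mem_S hw
  have := kappa_mul i (sec_mem_N hw false) (S_le_N h)
  rwa [mul_inv_cancel_left, kappa_of_mem_S i h, add_zero] at this

/-- Passing to a section gives nothing new for `kappa 0`, which is why the recursion for `kappa`
starts from `kappa 1`. -/
theorem kappa_zero_sec_false {w : W} (hw : w ∈ N) : kappa 0 (sec w false) = kappa 0 w := by
  have := parity_one_sec_true hw
  rw [kappa_zero, kappa_zero, alpha, ← this, alpha, beta, parity_succ 1 w]
  grind

theorem mem_S_of_kappa_eq_zero {w : W} (hw : w ∈ N) (h : ∀ i, kappa i w = 0) : w ∈ S := by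
  refine mem_S_of (P := fun w => w ∈ N ∧ ∀ i, kappa i w = 0) ?_ ⟨hw, h⟩
  rintro w ⟨hw, h⟩
  have hs : ∀ i, kappa i (sec w false) = 0 := by
    rintro (_ | i)
    · rw [kappa_zero_sec_false hw, h]
    · exact h (i + 2)
  refine ⟨?_, ?_⟩
  · have ha : alpha (sec w false) = parity 2 (sec w false) := CharTwo.add_eq_zero.1 (hs 0)
    have h1 : parity 1 (sec w true) = parity 2 (sec w false) := by
      rw [parity_one_sec_true hw, ← ha, alpha]
    have hb := beta_sec_of_mem_N hw
    have hk := h 1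
    -- The section is not yet known to lie in `S`, but `kappa 0 = 0` already provides the hypothesis
    -- on `beta`.
    have hc := cochC_mul (v := sec w false)
      (fun b => (beta_sec_eq_alpha (sec_mem_N hw false) b).trans ha)
      ((sec w false)⁻¹ * sec w true)
    rw [mul_inv_cancel_left, parity_inv_mul] at hc
    rw [kappa_one, h 0] at hk
    have q := zmodTwo_mul_self (parity 2 (sec w false))
    simp only [beta] at hb
    refine ⟨h1, ?_, ?_⟩ <;> grind
  · rintro (_ | _)
    · exact ⟨sec_mem_N hw _, hs⟩
    · exact ⟨sec_mem_N hw _, fun i => by rw [kappa_sec_true i hw, hs]⟩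

theorem continuous_kappa (i : ℕ) : Continuous (kappa i) := by
  have h0 : Continuous (kappa 0) :=
    (continuous_beta.comp (continuous_sec false)).add (continuous_parity 2)
  rcases i with _ | i
  · exact h0
  induction i with
  | zero =>
    exact ((continuous_cochC.comp ((continuous_sec false).inv.mul (continuous_sec true))).add
      ((continuous_parity 2).comp (continuous_sec false))).add h0
  | succ i ih => exact ih.comp (continuous_sec false)

/-- The summand `kappa 0` in `kappa 1` is a normalization that makes `kappa 1 w₀` vanish. -/
theorem kappa_w₀ (i : ℕ) : kappa i w₀ = if i = 0 then 1 else 0 := by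
  have h0 : kappa 0 w₀ = 1 := by simp [kappa_zero]
  rcases i with _ | i
  · simpa using h0
  induction i with
  | zero =>
    have e : (a₂ * w₀)⁻¹ * (a₃ * w₀) = w₀⁻¹ * (a₂ * a₃) * w₀ := by
      rw [mul_inv_rev, a₂_inv]
      group
    rw [kappa_one, h0, sec_w₀_false, sec_w₀_true, e,
      cochC_inv_conj_w₀ (S.mul_mem a₂_mem_S a₃_mem_S), cochC_mul_of_mem_S a₂_mem_S]
    simp [parity_mul, parity_a₂, CharTwo.add_self_eq_zero]
  | succ i ih =>
    rw [kappa_add_two, sec_w₀_false, kappa_mul _ (S_le_N a₂_mem_S) w₀_mem_N,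
      kappa_of_mem_S _ a₂_mem_S, ih]
    simp

theorem kappa_w (i j : ℕ) : kappa i (w j) = if i = j then 1 else 0 := by
  rcases j with _ | j
  · exact kappa_w₀ i
  have h0 : ∀ j, kappa 0 (w (j + 1)) = 0 := fun j => by
    rw [kappa_zero, alpha_w_succ, parity_w_succ, add_zero]
  induction j generalizing i with
  | zero =>
    rcases i with _ | _ | i
    · simpa using h0 0
    · rw [zero_add, kappa_one, ← zero_add 1, h0, zero_add, w_one]
      simp
    · rw [kappa_add_two, zero_add, w_one]
      simp
  | succ j ih =>
    rcases i with _ | _ | i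
    · simpa using h0 (j + 1)
    · rw [zero_add, kappa_one, h0]
      simp [w, parity_w_succ]
    · rw [kappa_add_two]
      simpa [w] using ih (i + 1)

/-! ### Convergence of the infinite products -/

theorem w_succ_apply (i : ℕ) : ∀ t : List Bool, t.length ≤ i + 1 → w (i + 1) t = t := by
  induction i with
  | zero =>
    rintro (_ | ⟨b, t⟩) ht
    · exact apply_nil _
    · obtain rfl : t = [] := by simpa using ht
      exact apply_singleton (w 1) b |>.trans (by simp [w])
  | succ i ih =>
    rintro (_ | ⟨b, t⟩) ht
    · exact apply_nil _
    · have := ih t (by simpa using ht)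
      rw [apply_cons]
      cases b <;> simp [w, this]

/-- The `i`-th factor of the infinite product. -/
noncomputable def factor (k : ℕ → ZMod 2) (i : ℕ) : W := if k i = 0 then 1 else w i

theorem partialProd_succ (k : ℕ → ZMod 2) (n : ℕ) :
    partialProd k (n + 1) = partialProd k n * factor k n := by
  simp [partialProd, List.range_succ, factor]

theorem factor_apply (k : ℕ → ZMod 2) {i : ℕ} {t : List Bool} (ht : t.length < i) :
    factor k i t = t := by
  obtain ⟨i, rfl⟩ : ∃ j, i = j + 1 := ⟨i - 1, by omega⟩
  rw [factor]
  split_ifs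
  · rfl
  · exact w_succ_apply i t ht.le

theorem partialProd_apply (k : ℕ → ZMod 2) {n : ℕ} {t : List Bool} (h : t.length < n) :
    partialProd k n t = partialProd k (t.length + 1) t := by
  induction n, h using Nat.le_induction with
  | base => rfl
  | succ n hn ih => rw [partialProd_succ, RelIso.mul_apply, factor_apply k hn, ih]

/-- The infinite product `w₀^{k₀} w₁^{k₁} w₂^{k₂} ⋯`. -/
noncomputable def infProd (k : ℕ → ZMod 2) : W :=
  ofFun (fun t => partialProd k (t.length + 1) t) (apply_nil _)
    (by
      intro t b
      obtain ⟨c, hc⟩ := apply_append (partialProd k (t.length + 1 + 1)) t b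
      refine ⟨c, ?_⟩
      rw [List.length_append, List.length_singleton, hc,
        partialProd_apply k (Nat.lt_succ_of_lt (Nat.lt_succ_self _))])
    (by
      intro s t h
      dsimp only at h
      rw [← partialProd_apply k (n := s.length + t.length + 1) (by omega),
        ← partialProd_apply k (n := s.length + t.length + 1) (by omega)] at h
      exact (partialProd k _).injective h)

theorem infProd_apply (k : ℕ → ZMod 2) (t : List Bool) :
    infProd k t = partialProd k (t.length + 1) t := rfl

theorem tendsto_partialProd (k : ℕ → ZMod 2) :
    Tendsto (partialProd k) atTop (𝓝 (infProd k)) := by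
  refine tendsto_nhds_iff.2 fun t => ?_
  filter_upwards [eventually_gt_atTop t.length] with n hn
  exact partialProd_apply k hn

theorem partialProd_congr {k l : ℕ → ZMod 2} {n : ℕ} (h : ∀ i < n, k i = l i) :
    partialProd k n = partialProd l n := by
  unfold partialProd
  congr 1
  refine List.map_congr_left fun i hi => ?_
  rw [h i (List.mem_range.1 hi)]

theorem continuous_infProd : Continuous infProd := by
  refine continuous_iff_continuousAt.2 fun k => tendsto_nhds_iff.2 fun t => ?_
  have h : ∀ i ∈ Finset.range (t.length + 1), ∀ᶠ l : ℕ → ZMod 2 in 𝓝 k, l i = k i := fun i _ =>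
    (continuous_apply i).continuousAt (isOpen_discrete {k i} |>.mem_nhds rfl)
  filter_upwards [(Finset.eventually_all _).2 h] with l hl
  rw [infProd_apply, infProd_apply, partialProd_congr fun i hi => hl i (Finset.mem_range.2 hi)]

theorem factor_mem_N (k : ℕ → ZMod 2) (i : ℕ) : factor k i ∈ N := by
  rw [factor]
  split_ifs
  exacts [N.one_mem, w_mem_N i]

theorem partialProd_mem_N (k : ℕ → ZMod 2) (n : ℕ) : partialProd k n ∈ N := by
  induction n with
  | zero => exact N.one_mem
  | succ n ih =>
    rw [partialProd_succ]
    exact N.mul_mem ih (factor_mem_N k n)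

theorem infProd_mem_N (k : ℕ → ZMod 2) : infProd k ∈ N :=
  isClosed_N.mem_of_tendsto (tendsto_partialProd k) (Eventually.of_forall (partialProd_mem_N k))

theorem kappa_factor (k : ℕ → ZMod 2) (i j : ℕ) :
    kappa i (factor k j) = if i = j then k i else 0 := by
  rw [factor]
  split_ifs with h h' h'
  · rw [kappa_apply_one, h', h]
  · exact kappa_apply_one i
  · have h2 : ∀ x : ZMod 2, x ≠ 0 → 1 = x := by decide
    rw [kappa_w, if_pos h', h', h2 _ h]
  · rw [kappa_w, if_neg h']

theorem kappa_partialProd (k : ℕ → ZMod 2) (i n : ℕ) :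
    kappa i (partialProd k n) = if i < n then k i else 0 := by
  induction n with
  | zero => exact kappa_apply_one i
  | succ n ih =>
    rw [partialProd_succ, kappa_mul i (partialProd_mem_N k n) (factor_mem_N k n), ih, kappa_factor]
    rcases lt_trichotomy i n with h | h | h
    · simp [h, h.ne, h.trans (Nat.lt_succ_self n)]
    · simp [h]
    · simp [h.ne', h.not_gt, Nat.not_lt.2 (Nat.succ_le_of_lt h)]

/-- Each coordinate is continuous and is eventually constant along the partial products. -/
theorem kappa_infProd (k : ℕ → ZMod 2) (i : ℕ) : kappa i (infProd k) = k i := by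
  have h := ((continuous_kappa i).tendsto (infProd k)).comp (tendsto_partialProd k)
  refine tendsto_nhds_unique h (tendsto_const_nhds.congr' ?_)
  filter_upwards [eventually_gt_atTop i] with n hn
  simp [kappa_partialProd, hn]

/-! ### The isomorphism -/

/-- The coordinates as a homomorphism on the normalizer. -/
noncomputable def kappaHom : N →* Multiplicative (ℕ → ZMod 2) where
  toFun v := Multiplicative.ofAdd fun i => kappa i v
  map_one' := by
    rw [← ofAdd_zero]
    exact congrArg _ (funext fun i => kappa_apply_one i)
  map_mul' v w := by
    rw [← ofAdd_add]
    exact congrArg _ (funext fun i => kappa_mul i v.2 w.2)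

theorem kappaHom_apply (v : N) :
    kappaHom v = Multiplicative.ofAdd fun i => kappa i (v : W) := rfl

theorem ker_kappaHom : kappaHom.ker = G.subgroupOf N := by
  ext v
  rw [MonoidHom.mem_ker, Subgroup.mem_subgroupOf, G_eq_S, kappaHom_apply, ofAdd_eq_one,
    funext_iff]
  exact ⟨mem_S_of_kappa_eq_zero v.2, fun h i => kappa_of_mem_S i h⟩

/-- The infinite product as an element of the normalizer. -/
noncomputable def phi (k : ℕ → ZMod 2) : N := ⟨infProd k, infProd_mem_N k⟩

theorem kappaHom_phi (k : ℕ → ZMod 2) : kappaHom (phi k) = Multiplicative.ofAdd k :=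
  congrArg Multiplicative.ofAdd (funext (kappa_infProd k))

theorem continuous_kappaHom : Continuous kappaHom :=
  continuous_ofAdd.comp
    (continuous_pi fun i => (continuous_kappa i).comp continuous_subtype_val)

theorem continuous_phi : Continuous phi := continuous_infProd.subtype_mk _

/-- The homomorphism induced by `kappaHom` on the quotient. -/
noncomputable def kappaBar : N ⧸ G.subgroupOf N →* Multiplicative (ℕ → ZMod 2) :=
  QuotientGroup.lift _ kappaHom ker_kappaHom.ge

theorem kappaBar_mk (v : N) : kappaBar (v : N ⧸ G.subgroupOf N) = kappaHom v := rfl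

theorem kappaBar_injective : Function.Injective kappaBar := by
  refine (injective_iff_map_eq_one _).2 fun q => ?_
  refine QuotientGroup.induction_on q fun v hv => ?_
  rw [kappaBar_mk, ← MonoidHom.mem_ker, ker_kappaHom] at hv
  exact (QuotientGroup.eq_one_iff v).2 hv

theorem continuous_kappaBar : Continuous kappaBar :=
  continuous_kappaHom.quotient_lift _

/-- The isomorphism of the product of copies of `𝔽₂` with `N / G`. -/
noncomputable def phiBar : Multiplicative (ℕ → ZMod 2) ≃ₜ* (N ⧸ G.subgroupOf N) where
  toFun k := (phi k.toAdd : N ⧸ G.subgroupOf N)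
  invFun := kappaBar
  left_inv k := kappaHom_phi k.toAdd
  right_inv q := kappaBar_injective (kappaHom_phi (kappaBar q).toAdd)
  map_mul' k l := by
    -- `phi` is a section, not visibly multiplicative; multiplicativity modulo `G` is tested on
    -- coordinates.
    refine kappaBar_injective ?_
    rw [map_mul kappaBar, kappaBar_mk, kappaBar_mk, kappaBar_mk, kappaHom_phi, kappaHom_phi,
      kappaHom_phi]
    rfl
  continuous_toFun := continuous_quotient_mk'.comp (continuous_phi.comp continuous_toAdd)
  continuous_invFun := continuous_kappaBar

end RootedBinary

theorem mainTheorem6 :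
    ∃ φ : (ℕ → ZMod 2) → RootedBinary.N,
      (∀ k : ℕ → ZMod 2,
        Tendsto (RootedBinary.partialProd k) atTop (𝓝 (φ k : RootedBinary.W))) ∧
      ∃ φbar : Multiplicative (ℕ → ZMod 2) ≃ₜ*
          (RootedBinary.N ⧸ RootedBinary.G.subgroupOf RootedBinary.N),
        ∀ k : ℕ → ZMod 2,
          φbar (Multiplicative.ofAdd k) =
            (φ k : RootedBinary.N ⧸ RootedBinary.G.subgroupOf RootedBinary.N) :=
  ⟨RootedBinary.phi, RootedBinary.tendsto_partialProd, RootedBinary.phiBar, fun _ => rfl⟩
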